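/- Let $k$ be a commutative artinian ring and let $(\mathcal C,\mathbb E,\mathfrak s)$ be a $k$-linear extriangulated category (in the sense of Nakaoka–Palu) which is Krull–Schmidt (every object is a finite direct sum of objects with local endomorphism rings) and Ext-finite (every $\mathbb E(A,B)$ is a finitely generated $k$-module). Assume the condition (WIC): for composable $f,g$, if $g\circ f$ is an $\mathfrak s$-inflation then so is $f$, and if $g\circ f$ is an $\mathfrak s$-deflation then so is $g$. Conventions. A morphism $f\colon C'\to C$ is $\mathfrak s$-projective if $\mathbb E(f,A)=0$ for all $A$, and $\mathfrak s$-injective if $\mathbb E(A,f)=0$ for all $A$; an object is $\mathfrak s$-projective if its identity is; $\mathcal P(C,Y)$ is the set of $\mathfrak s$-projective morphisms $C\to Y$, and $\overline{\mathcal C}$ is the quotient of $\mathcal C$ by the ideal of $\mathfrak s$-injective morphisms. Put $D=\operatorname{Hom}_k(-,\check k)$ with $\check k$ the minimal injective cogenerator of the category $k\text{-mod}$ of finitely generated $k$-modules (the injective hull of $k/\operatorname{rad}k$). Let $\mathcal C_r$ be the class of objects $C$ for which the contravariant functor $D\mathbb E(C,-)\colon\overline{\mathcal C}\to k\text{-mod}$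 is representable. A morphism $\alpha\colon X\to Y$ is right $C$-determined if every $g\colon T\to Y$ such that $g\circ h$ factors through $\alpha$ for all $h\colon C\to T$ itself factors through $\alpha$; left $K$-determined is the dual notion. An extension $0\ne\delta\in\mathbb E(C,A)$, and every $\mathfrak s$-triangle $A\to B\to C\overset{\delta}{\dashrightarrow}$ on it, is almost split if $a_\star\delta=0$ for every $a\colon A\to A'$ that is not a section and $c^\star\delta=0$ for every $c\colon C'\to C$ that is not a retraction. A morphism $f\colon C\to Y$ almost factors through $\alpha\colon X\to Y$ if it does not factor through $\alpha$ but $f\circ h$ does for every $T$ and every $h\in\operatorname{rad}_{\mathcal C}(T,C)$. An object $C$ is an intrinsic weak cokernel of an $\mathfrak s$-inflation $\alpha\colon X\to Y$ if there is an $\mathfrak s$-triangle $X\overset{g}{\to}Y'\to C\dashrightarrow$ with $g$ left minimal (each $u\colon Y'\to Y'$ with $u\circ g=g$ is an automorphism) such that $\alpha$ and $g$ factor through each other. Theorem. For every object $C$ of $\mathcal C$, the following are equivalent. 1. $C\in\mathcal C_r$. 2. For each object $Y$ and each right $\operatorname{End}(C)$-submodule $H$ of $\mathcal C(C,Y)$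 with $\mathcal P(C,Y)\subseteq H$, there is a right $C$-determined $\mathfrak s$-deflation $\alpha\colon X\to Y$ with $H=\operatorname{Im}\mathcal C(C,\alpha)$. If moreover $C$ is indecomposable and not $\mathfrak s$-projective, then (1) and (2) are also equivalent to each of the following. 3. $C$ is an intrinsic weak cokernel of some $\mathfrak s$-inflation $\alpha\colon X\to Y$ which is left $K$-determined for some object $K$. 4. There exists an almost split $\mathfrak s$-triangle ending at $C$. 5. There exists an $\mathfrak s$-deflation which is not a retraction and is right $C$-determined. 6. There exist an $\mathfrak s$-deflation $\alpha\colon X\to Y$ and a morphism $f\colon C\to Y$ such that $f$ almost factors through $\alpha$. -/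

import Mathlib

open CategoryTheory CategoryTheory.Limits Opposite

universe u v t w

namespace ExtriCat

/-! ## The duality `D` over a commutative ring -/

section Duality

/-- Every module has an injective hull: an essential embedding into an injective module. -/
theorem exists_injectiveHull (k : Type u) [CommRing k] (M : Type u) [AddCommGroup M]
    [Module k M] :
    ∃ J : ModuleCat.{u} k, Module.Injective k J ∧ ∃ i : M →ₗ[k] J, Function.Injective i ∧
      ∀ N : Submodule k J, N ⊓ LinearMap.range i = ⊥ → N = ⊥ := by
  obtain ⟨I, hI, j, hj⟩ : ∃ I : ModuleCat.{u} k, Module.Injective k I ∧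
      ∃ j : M →ₗ[k] I, Function.Injective j := by
    obtain ⟨pr⟩ := EnoughInjectives.presentation (ModuleCat.of k M)
    have h1 := pr.injective
    have h2 := pr.mono
    refine ⟨pr.J, ?_, pr.f.hom, (ModuleCat.mono_iff_injective _).1 h2⟩
    have h3 : Injective (ModuleCat.of k pr.J) := h1
    exact Module.injective_module_of_injective_object k pr.J
  set S := LinearMap.range j with hS
  -- a maximal essential extension `E` of `S` inside `I`
  let P : Set (Submodule k I) := {E | S ≤ E ∧ ∀ N ≤ E, N ⊓ S = ⊥ → N = ⊥}
  obtain ⟨E, -, hE⟩ := zorn_le_nonempty₀ P (by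
    intro c hc hchain y hy
    refine ⟨sSup c, ⟨(hc hy).1.trans (le_sSup hy), ?_⟩, fun z hz => le_sSup hz⟩
    intro N hN hNS
    rw [eq_bot_iff]
    intro x hx
    obtain ⟨F, hF, hxF⟩ := (Submodule.mem_sSup_of_directed ⟨y, hy⟩ hchain.directedOn).1 (hN hx)
    have h1 : Submodule.span k {x} = ⊥ := by
      apply (hc hF).2
      · rw [Submodule.span_singleton_le_iff_mem]; exact hxF
      · rw [eq_bot_iff, ← hNS]
        exact inf_le_inf_right _ ((Submodule.span_singleton_le_iff_mem _ _).2 hx)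
    rw [Submodule.span_singleton_eq_bot] at h1
    simp [h1]) S ⟨le_rfl, fun N hN h => by rwa [inf_eq_left.2 hN] at h⟩
  -- a maximal submodule `L` meeting `E` trivially
  obtain ⟨L, -, hL⟩ := zorn_le_nonempty₀ {N : Submodule k I | N ⊓ E = ⊥} (by
    intro c hc hchain y hy
    refine ⟨sSup c, ?_, fun z hz => le_sSup hz⟩
    change sSup c ⊓ E = ⊥
    rw [eq_bot_iff]
    rintro x ⟨hx, hxE⟩
    obtain ⟨F, hF, hxF⟩ := (Submodule.mem_sSup_of_directed ⟨y, hy⟩ hchain.directedOn).1 hx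
    have : F ⊓ E = ⊥ := hc hF
    rw [← this]
    exact ⟨hxF, hxE⟩) ⊥ (by simp)
  have hLE : L ⊓ E = ⊥ := hL.prop
  obtain ⟨φ, hφ⟩ := Module.Injective.extension_property k I E (I ⧸ L) (L.mkQ ∘ₗ E.subtype) (by
    rw [← LinearMap.ker_eq_bot, eq_bot_iff]
    intro x hx
    have h1 : (x : I) ∈ L := by simpa using hx
    have h2 : (x : I) ∈ L ⊓ E := ⟨h1, x.2⟩
    rw [hLE] at h2
    simpa using h2) E.subtype
  let ψ : I →ₗ[k] I := φ ∘ₗ L.mkQ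
  have hψE : ∀ x ∈ E, ψ x = x := fun x hx => LinearMap.congr_fun hφ ⟨x, hx⟩
  have hψL : ∀ x ∈ L, ψ x = 0 := fun x hx => by
    have : L.mkQ x = 0 := by simpa using hx
    simp [ψ, this]
  have hrange : LinearMap.range ψ ≤ E := by
    apply hE.le_of_ge
    · refine ⟨fun x hx => ⟨x, hψE x (hE.prop.1 hx)⟩, ?_⟩
      intro N hN hNS
      have hNE : N ⊓ E = ⊥ := by
        apply hE.prop.2 _ inf_le_right
        rw [eq_bot_iff, ← hNS]
        exact inf_le_inf_right _ inf_le_left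
      have hK : N.comap ψ ≤ L := by
        apply hL.le_of_ge
        · change N.comap ψ ⊓ E = ⊥
          rw [eq_bot_iff, ← hNE]
          rintro x ⟨hx, hxE⟩
          refine ⟨?_, hxE⟩
          have : ψ x ∈ N := hx
          rwa [hψE x hxE] at this
        · intro x hx
          change ψ x ∈ N
          rw [hψL x hx]
          exact N.zero_mem
      rw [eq_bot_iff]
      intro x hx
      obtain ⟨y, rfl⟩ := hN hx
      have := hψL y (hK hx)
      simp [this]
    · exact fun x hx => ⟨x, hψE x hx⟩
  refine ⟨ModuleCat.of k E, ⟨?_⟩, j.codRestrict E (fun m => hE.prop.1 ⟨m, rfl⟩), ?_, ?_⟩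
  · intro X Y _ _ _ _ f hf g
    obtain ⟨h, hh⟩ := hI.out f hf (E.subtype ∘ₗ g)
    refine ⟨(ψ.codRestrict E fun x => hrange ⟨x, rfl⟩) ∘ₗ h, fun x => ?_⟩
    apply Subtype.ext
    change ψ (h (f x)) = _
    rw [hh]
    exact hψE _ (g x).2
  · intro a b hab
    exact hj (congrArg Subtype.val hab)
  · intro N hN
    have h1 : N.map E.subtype = ⊥ := by
      apply hE.prop.2
      · exact Submodule.map_subtype_le E N
      · rw [eq_bot_iff]
        rintro _ ⟨⟨x, hx, rfl⟩, ⟨m, hm⟩⟩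
        have h2 : x ∈ N ⊓ LinearMap.range
            (j.codRestrict E (fun m => hE.prop.1 ⟨m, rfl⟩)) :=
          ⟨hx, ⟨m, Subtype.ext hm⟩⟩
        have h3 : x ∈ (⊥ : Submodule k E) := hN ▸ h2
        have h4 : x = 0 := by simpa using h3
        simp [h4]
    rw [eq_bot_iff]
    intro x hx
    have h2 : (x : I) ∈ N.map E.subtype := ⟨x, hx, rfl⟩
    rw [h1] at h2
    simpa using h2

/-- The injective hull of `k / rad k`. When `k` is artinian, this is the minimal injective
cogenerator of the category of (finitely generated) `k`-modules. -/
noncomputable def minInjCogen (k : Type u) [CommRing k] : ModuleCat.{u} k :=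
  (exists_injectiveHull k (k ⧸ Ring.jacobson k)).choose

theorem minInjCogen_spec (k : Type u) [CommRing k] :
    Module.Injective k (minInjCogen k) ∧
      ∃ i : (k ⧸ Ring.jacobson k) →ₗ[k] minInjCogen k, Function.Injective i ∧
        ∀ N : Submodule k (minInjCogen k), N ⊓ LinearMap.range i = ⊥ → N = ⊥ :=
  (exists_injectiveHull k (k ⧸ Ring.jacobson k)).choose_spec

/-- The dual `D M = Hom_k(M, J)`, where `J` is the minimal injective cogenerator. -/
abbrev D (k : Type u) [CommRing k] (M : Type w) [AddCommGroup M] [Module k M] :=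
  M →ₗ[k] minInjCogen k

end Duality

/-! ## Notions in an arbitrary category or additive category -/

section Basic

variable {C : Type t} [Category.{v} C]

/-- `g : T ⟶ Y` factors through `f : X ⟶ Y`. -/
def FactorsThrough {X Y T : C} (g : T ⟶ Y) (f : X ⟶ Y) : Prop :=
  ∃ s : T ⟶ X, s ≫ f = g

/-- `g : X ⟶ T` factors through `f : X ⟶ Y` (maps with a common source). -/
def CofactorsThrough {X Y T : C} (g : X ⟶ T) (f : X ⟶ Y) : Prop :=
  ∃ s : Y ⟶ T, f ≫ s = g

/-- `f` is right `Z`-determined. -/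
def RightDetermined (Z : C) {X Y : C} (f : X ⟶ Y) : Prop :=
  ∀ ⦃T : C⦄ (g : T ⟶ Y), (∀ h : Z ⟶ T, FactorsThrough (h ≫ g) f) → FactorsThrough g f

/-- `f` is left `K`-determined. -/
def LeftDetermined (K : C) {X Y : C} (f : X ⟶ Y) : Prop :=
  ∀ ⦃T : C⦄ (g : X ⟶ T), (∀ h : T ⟶ K, CofactorsThrough (g ≫ h) f) → CofactorsThrough g f

/-- `f : X ⟶ Y` is left minimal. -/
def LeftMinimal {X Y : C} (f : X ⟶ Y) : Prop :=
  ∀ g : Y ⟶ Y, f ≫ g = f → IsIso g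

/-- `f` and `f'`, with a common source, are left equivalent. -/
def LeftEquivalent {X Y Y' : C} (f : X ⟶ Y) (f' : X ⟶ Y') : Prop :=
  CofactorsThrough f f' ∧ CofactorsThrough f' f

/-- `f : X ⟶ Y` lies in the radical of the category. -/
def InRadical [Preadditive C] {X Y : C} (f : X ⟶ Y) : Prop :=
  ∀ ⦃Z : C⦄ (g : Z ⟶ X) (h : Y ⟶ Z), (show End Z from g ≫ f ≫ h) ∈ Ring.jacobson (End Z)

/-- `g : Z ⟶ Y` almost factors through `f : X ⟶ Y`. -/
def AlmostFactorsThrough [Preadditive C] {X Y Z : C} (g : Z ⟶ Y) (f : X ⟶ Y) : Prop :=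
  ¬ FactorsThrough g f ∧ ∀ ⦃T : C⦄ (h : T ⟶ Z), InRadical h → FactorsThrough (h ≫ g) f

/-- Krull-Schmidt: every object is a finite direct sum of objects with local endomorphism
rings. -/
def KrullSchmidt (C : Type t) [Category.{v} C] [Preadditive C] [HasFiniteBiproducts C] : Prop :=
  ∀ X : C, ∃ (n : ℕ) (F : Fin n → C), (∀ i, IsLocalRing (End (F i))) ∧ Nonempty (X ≅ ⨁ F)

/-- Sequences `A ⟶ mid ⟶ Z` with fixed ends. -/
structure ShortSeq (A Z : C) where
  mid : C
  i : A ⟶ mid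
  p : mid ⟶ Z

/-- Equivalence of sequences: an isomorphism of the middle terms that is the identity on the
ends. -/
instance ShortSeq.setoid (A Z : C) : Setoid (ShortSeq A Z) where
  r S T := ∃ e : S.mid ≅ T.mid, S.i ≫ e.hom = T.i ∧ e.hom ≫ T.p = S.p
  iseqv :=
    { refl := fun S => ⟨Iso.refl _, by simp, by simp⟩
      symm := by
        rintro S T ⟨e, h1, h2⟩
        exact ⟨e.symm, by simp [← h1], by simp [← h2]⟩
      trans := by
        rintro S T U ⟨e, h1, h2⟩ ⟨f, h3, h4⟩
        exact ⟨e ≪≫ f, by simp [← h3, ← h1], by simp [← h2, ← h4]⟩ }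

end Basic

/-! ## Extriangulated categories -/

section Bifunctor

variable {k : Type u} [CommRing k] {C : Type t} [Category.{v} C]
  (E : Cᵒᵖ ⥤ C ⥤ ModuleCat.{w} k)

/-- The module `E(Z, A)` of extensions. -/
abbrev Extn (Z A : C) : Type w := (E.obj (op Z)).obj A

variable {E}

/-- `a_⋆ δ` for `a : A ⟶ A'` and `δ ∈ E(Z, A)`. -/
def push {Z A A' : C} (a : A ⟶ A') : Extn E Z A →ₗ[k] Extn E Z A' :=
  ((E.obj (op Z)).map a).hom

/-- `c^⋆ δ` for `c : Z' ⟶ Z` and `δ ∈ E(Z, A)`. -/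
def pull {Z Z' A : C} (c : Z' ⟶ Z) : Extn E Z A →ₗ[k] Extn E Z' A :=
  ((E.map c.op).app A).hom

variable (E)

/-- `E` is additive and `k`-linear in each variable. -/
structure IsBilinear [Preadditive C] [Linear k C] : Prop where
  push_add : ∀ {Z A A' : C} (a b : A ⟶ A') (δ : Extn E Z A),
    push (a + b) δ = push a δ + push b δ
  push_smul : ∀ {Z A A' : C} (r : k) (a : A ⟶ A') (δ : Extn E Z A),
    push (r • a) δ = r • push a δ
  pull_add : ∀ {Z Z' A : C} (c d : Z' ⟶ Z) (δ : Extn E Z A),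
    pull (c + d) δ = pull c δ + pull d δ
  pull_smul : ∀ {Z Z' A : C} (r : k) (c : Z' ⟶ Z) (δ : Extn E Z A),
    pull (r • c) δ = r • pull c δ

variable {E}

/-- `δ ⊕ δ' ∈ E(Z ⊕ Z', A ⊕ A')`, the extension with components `(δ, 0, 0, δ')`. -/
noncomputable def dsum [Preadditive C] [HasBinaryBiproducts C] {Z A Z' A' : C}
    (δ : Extn E Z A) (δ' : Extn E Z' A') : Extn E (Z ⊞ Z') (A ⊞ A') :=
  pull (biprod.fst : Z ⊞ Z' ⟶ Z) (push (biprod.inl : A ⟶ A ⊞ A') δ) +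
    pull (biprod.snd : Z ⊞ Z' ⟶ Z') (push (biprod.inr : A' ⟶ A ⊞ A') δ')

end Bifunctor

/-- A `k`-linear extriangulated category: an additive `k`-linear category `C` with a bifunctor
`E` (ET1) and an additive realization `s` (ET2) satisfying (ET3), (ET4) and their duals. -/
structure LinearExtriangulated (k : Type u) [CommRing k] (C : Type t) [Category.{v} C]
    [Preadditive C] [Linear k C] [HasFiniteBiproducts C] [HasBinaryBiproducts C] where
  /-- the bifunctor of extensions -/
  E : Cᵒᵖ ⥤ C ⥤ ModuleCat.{w} k
  /-- (ET1) -/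
  bilinear : IsBilinear E
  /-- the correspondence sending an extension to an equivalence class of sequences -/
  s : ∀ {Z A : C}, Extn E Z A → Quotient (ShortSeq.setoid A Z)
  /-- (ET2): `s` is a realization -/
  realization : ∀ {A B Z A' B' Z' : C} (x : A ⟶ B) (y : B ⟶ Z) (x' : A' ⟶ B') (y' : B' ⟶ Z')
    (δ : Extn E Z A) (δ' : Extn E Z' A'), s δ = ⟦⟨B, x, y⟩⟧ → s δ' = ⟦⟨B', x', y'⟩⟧ →
    ∀ (a : A ⟶ A') (c : Z ⟶ Z'), push a δ = pull c δ' →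
      ∃ b : B ⟶ B', x ≫ b = a ≫ x' ∧ y ≫ c = b ≫ y'
  /-- (ET2): `s` is additive, first condition -/
  s_zero : ∀ Z A : C, s (0 : Extn E Z A) = ⟦⟨A ⊞ Z, biprod.inl, biprod.snd⟩⟧
  /-- (ET2): `s` is additive, second condition -/
  s_dsum : ∀ {A B Z A' B' Z' : C} (x : A ⟶ B) (y : B ⟶ Z) (x' : A' ⟶ B') (y' : B' ⟶ Z')
    (δ : Extn E Z A) (δ' : Extn E Z' A'), s δ = ⟦⟨B, x, y⟩⟧ → s δ' = ⟦⟨B', x', y'⟩⟧ →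
    s (dsum δ δ') = ⟦⟨B ⊞ B', biprod.map x x', biprod.map y y'⟩⟧
  /-- (ET3) -/
  et3 : ∀ {A B Z A' B' Z' : C} (x : A ⟶ B) (y : B ⟶ Z) (x' : A' ⟶ B') (y' : B' ⟶ Z')
    (δ : Extn E Z A) (δ' : Extn E Z' A'), s δ = ⟦⟨B, x, y⟩⟧ → s δ' = ⟦⟨B', x', y'⟩⟧ →
    ∀ (a : A ⟶ A') (b : B ⟶ B'), x ≫ b = a ≫ x' →
      ∃ c : Z ⟶ Z', y ≫ c = b ≫ y' ∧ push a δ = pull c δ'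
  /-- (ET3)ᵒᵖ -/
  et3_op : ∀ {A B Z A' B' Z' : C} (x : A ⟶ B) (y : B ⟶ Z) (x' : A' ⟶ B') (y' : B' ⟶ Z')
    (δ : Extn E Z A) (δ' : Extn E Z' A'), s δ = ⟦⟨B, x, y⟩⟧ → s δ' = ⟦⟨B', x', y'⟩⟧ →
    ∀ (b : B ⟶ B') (c : Z ⟶ Z'), y ≫ c = b ≫ y' →
      ∃ a : A ⟶ A', x ≫ b = a ≫ x' ∧ push a δ = pull c δ'
  /-- (ET4) -/
  et4 : ∀ {A B Z G F : C} (x : A ⟶ B) (y : B ⟶ Z) (p : B ⟶ G) (q : G ⟶ F)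
    (δ : Extn E Z A) (ρ : Extn E F B), s δ = ⟦⟨B, x, y⟩⟧ → s ρ = ⟦⟨G, p, q⟩⟧ →
    ∃ (H : C) (z : A ⟶ G) (r : G ⟶ H) (m : Z ⟶ H) (n : H ⟶ F) (ξ : Extn E H A),
      s ξ = ⟦⟨G, z, r⟩⟧ ∧ x ≫ p = z ∧ y ≫ m = p ≫ r ∧ r ≫ n = q ∧
      s (push y ρ) = ⟦⟨H, m, n⟩⟧ ∧ pull m ξ = δ ∧ push x ξ = pull n ρ
  /-- (ET4)ᵒᵖ -/
  et4_op : ∀ {A B Z G F : C} (y : Z ⟶ B) (x : B ⟶ A) (q : F ⟶ G) (p : G ⟶ B)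
    (δ : Extn E A Z) (ρ : Extn E B F), s δ = ⟦⟨B, y, x⟩⟧ → s ρ = ⟦⟨G, q, p⟩⟧ →
    ∃ (H : C) (r : H ⟶ G) (z : G ⟶ A) (n : F ⟶ H) (m : H ⟶ Z) (ξ : Extn E A H),
      s ξ = ⟦⟨G, r, z⟩⟧ ∧ p ≫ x = z ∧ m ≫ y = r ≫ p ∧ n ≫ r = q ∧
      s (pull y ρ) = ⟦⟨H, n, m⟩⟧ ∧ push m ξ = δ ∧ pull x ξ = push n ρ

namespace LinearExtriangulated

variable {k : Type u} [CommRing k] {C : Type t} [Category.{v} C] [Preadditive C] [Linear k C]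
  [HasFiniteBiproducts C] [HasBinaryBiproducts C]
  (X : LinearExtriangulated.{u, v, t, w} k C)

/-- `A ⟶ B ⟶ Z` with `δ` is an `s`-triangle. -/
def IsTriangle {A B Z : C} (x : A ⟶ B) (y : B ⟶ Z) (δ : Extn X.E Z A) : Prop :=
  X.s δ = ⟦⟨B, x, y⟩⟧

/-- `s`-inflations -/
def IsInflation {A B : C} (x : A ⟶ B) : Prop :=
  ∃ (Z : C) (y : B ⟶ Z) (δ : Extn X.E Z A), X.IsTriangle x y δ

/-- `s`-deflations -/
def IsDeflation {B Z : C} (y : B ⟶ Z) : Prop :=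
  ∃ (A : C) (x : A ⟶ B) (δ : Extn X.E Z A), X.IsTriangle x y δ

/-- The (WIC) condition. -/
def WIC : Prop :=
  (∀ ⦃A B Z : C⦄ (f : A ⟶ B) (g : B ⟶ Z), X.IsInflation (f ≫ g) → X.IsInflation f) ∧
  (∀ ⦃A B Z : C⦄ (f : A ⟶ B) (g : B ⟶ Z), X.IsDeflation (f ≫ g) → X.IsDeflation g)

/-- Ext-finiteness -/
def ExtFinite : Prop :=
  ∀ Z A : C, Module.Finite k (Extn X.E Z A)

/-- `s`-projective morphisms -/
def ProjMor {Z' Z : C} (f : Z' ⟶ Z) : Prop :=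
  ∀ (A : C) (δ : Extn X.E Z A), pull f δ = 0

/-- `s`-projective objects -/
def ProjObj (Z : C) : Prop := X.ProjMor (𝟙 Z)

/-- The submodule of `s`-injective morphisms `M ⟶ T`; the morphisms from `M` to `T` in the
costable category are the quotient `(M ⟶ T) ⧸ X.injMor M T`. -/
def injMor (M T : C) : Submodule k (M ⟶ T) where
  carrier := {f | ∀ (A : C) (δ : Extn X.E A M), push f δ = 0}
  add_mem' := fun {f g} hf hg A δ => by rw [X.bilinear.push_add, hf A δ, hg A δ, add_zero]
  zero_mem' := fun A δ => by
    have h := X.bilinear.push_smul (0 : k) (0 : M ⟶ T) δ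
    rwa [zero_smul, zero_smul] at h
  smul_mem' := fun r f hf A δ => by rw [X.bilinear.push_smul, hf A δ, smul_zero]

/-- Membership in `C_r`: the contravariant functor `M ↦ D E(Z, M)` on the costable category is
representable, i.e. there are an object `T` and `k`-linear isomorphisms from the costable
morphisms `M ⟶ T` to `D E(Z, M)` that are natural in `M`. (Every costable morphism is the class
of a morphism `f : M' ⟶ M` of `C`, so naturality is tested on those.) -/
def MemCr (Z : C) : Prop :=
  ∃ (T : C) (φ : ∀ M : C, ((M ⟶ T) ⧸ X.injMor M T) ≃ₗ[k] D k (Extn X.E Z M)),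
    ∀ ⦃M' M : C⦄ (f : M' ⟶ M) (g : M ⟶ T) (μ : Extn X.E Z M'),
      φ M' ((X.injMor M' T).mkQ (f ≫ g)) μ = φ M ((X.injMor M T).mkQ g) (push f μ)

/-- Almost split extensions -/
def AlmostSplit {Z A : C} (δ : Extn X.E Z A) : Prop :=
  δ ≠ 0 ∧ (∀ ⦃A' : C⦄ (a : A ⟶ A'), ¬ IsSplitMono a → push a δ = 0) ∧
    (∀ ⦃Z' : C⦄ (c : Z' ⟶ Z), ¬ IsSplitEpi c → pull c δ = 0)

/-- `Z` is an intrinsic weak cokernel of `f : A ⟶ B`: `f` is an `s`-inflation whose left minimal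
version `g` is the first map of an `s`-triangle ending at `Z`. -/
def IsIntrinsicWeakCokernel (Z : C) {A B : C} (f : A ⟶ B) : Prop :=
  X.IsInflation f ∧ ∃ (B' : C) (g : A ⟶ B') (h : B' ⟶ Z) (δ : Extn X.E Z A),
    LeftMinimal g ∧ LeftEquivalent f g ∧ X.IsTriangle g h δ

end LinearExtriangulated

end ExtriCat

/-!
Everything is reduced to functionals on extension modules. By the Yoneda lemma, `D E(Z, -)` is
representable if and only if there is a functional `Φ` on some `E(Z, T)` for which
`(g, μ) ↦ Φ (g_⋆ μ)` identifies the costable morphisms `M ⟶ T` with `D E(Z, M)`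
(`memCr_iff_exists_isUniversal`). Such a `Φ` also makes the pairing `(ξ, f) ↦ Φ (f^⋆ ξ)` between
`E(Y, T)` and `C(Z, Y)` nondegenerate modulo the `s`-projective morphisms
(`IsUniversal.eq_zero_of_pull`, `IsUniversal.projMor_of_pull`). By Ext-finiteness and duality over
`k`, a submodule `H` of `C(Z, Y)` containing these morphisms is its own double annihilator. The
annihilator of `H` in `E(Y, T)` is generated by finitely many extensions; together they form an
extension of `Y` by a power of `T`, whose deflation is right `Z`-determined and has image `H`
(`MemCr.hasDeterminedDeflations`).

Conversely, the submodule of non-retractions from `Z` to a summand `W` with local endomorphism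
ring, not `s`-projective, determines a right almost split deflation. Projecting its extension to a
suitable summand of the first term gives an almost split extension of `W`
(`HasDeterminedDeflations.exists_almostSplit`). A functional that is nonzero on an almost split
extension is universal (`AlmostSplit.memCr`), and representability passes to finite direct sums
(`MemCr.biproduct`).

The conditions for an indecomposable `Z` all lead to an almost split extension. For an almost
factorization and for a left determined inflation the point is that a nonzero element of an
extension module, which has finite length over `k`, has a nonzero multiple in the socle for the
action of an endomorphism ring (`exists_smul_mem_socle`), and such an element is killed by radical
morphisms. A nonzero extension of `Z` by `A` that is killed by all non-retractions ending at `Z` is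
almost split as soon as `End A` is local, which is arranged by projecting to a summand of `A`;
dually, as `End Z` is local, it is enough that it is killed by all non-sections starting at `A`
(`AlmostSplit.of_pull_eq_zero`, `AlmostSplit.of_push_eq_zero`).
-/

namespace ExtriCat

/-! ### Duality over an artinian ring -/

section Duality

variable {k : Type u} [CommRing k]

/-- The injectivity of `minInjCogen k`, tested on modules in arbitrary universes. -/
theorem exists_extend_minInjCogen {M N : Type*} [AddCommGroup M] [Module k M] [AddCommGroup N]
    [Module k N] (i : M →ₗ[k] N) (hi : Function.Injective i) (f : D k M) :
    ∃ g : D k N, ∀ m, g (i m) = f m := by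
  obtain ⟨h, hh⟩ := Module.Baer.extension_property
    (Module.Baer.of_injective (minInjCogen_spec k).1) i hi f
  exact ⟨h, fun m => LinearMap.congr_fun hh m⟩

/-- The part of `minInjCogen k` that is killed by a given maximal ideal is zero or simple: any
nonzero element generates it. -/
theorem exists_smul_eq_of_maximal (m : Ideal k) [hm : m.IsMaximal] {x y : minInjCogen k}
    (hx0 : x ≠ 0) (hx : ∀ r ∈ m, r • x = 0) (hy : ∀ r ∈ m, r • y = 0) : ∃ r : k, r • x = y := by
  obtain ⟨-, i, hi, hess⟩ := minInjCogen_spec k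
  -- by essentiality, every element killed by `m` comes from `k / rad k`
  have key : ∀ z : minInjCogen k, (∀ r ∈ m, r • z = 0) →
      ∃ a : k, i (Submodule.Quotient.mk a) = z := by
    intro z hz
    by_cases hz0 : z = 0
    · exact ⟨0, by simp [hz0]⟩
    have h1 : Submodule.span k {z} ⊓ LinearMap.range i ≠ ⊥ := fun h => by
      have := hess _ h
      rw [Submodule.span_singleton_eq_bot] at this
      exact hz0 this
    obtain ⟨z', ⟨h2, h3⟩, h4⟩ := Submodule.exists_mem_ne_zero_of_ne_bot h1
    obtain ⟨r, rfl⟩ := Submodule.mem_span_singleton.1 h2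
    have hr : r ∉ m := fun h => h4 (hz r h)
    obtain ⟨s, t, ht, hst⟩ := hm.exists_inv hr
    obtain ⟨q, hq⟩ := h3
    obtain ⟨a, rfl⟩ := Submodule.Quotient.mk_surjective _ q
    refine ⟨s * a, ?_⟩
    have h5 : z = (s * r) • z := by
      have : z = (s * r + t) • z := by rw [hst, one_smul]
      rwa [add_smul, hz t ht, add_zero] at this
    rw [h5, mul_smul, ← hq, ← map_smul]
    rfl
  obtain ⟨a, rfl⟩ := key x hx
  obtain ⟨b, rfl⟩ := key y hy
  have hrad : ∀ c : k, (∀ r ∈ m, r • i (Submodule.Quotient.mk c) = 0) →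
      ∀ r ∈ m, r * c ∈ Ring.jacobson k := by
    intro c hc r hr
    have h1 := hc r hr
    rw [← map_smul, map_eq_zero_iff i hi, ← Submodule.Quotient.mk_smul,
      Submodule.Quotient.mk_eq_zero] at h1
    exact h1
  have ha : a ∉ m := by
    intro ham
    apply hx0
    have h1 : a ∈ Ring.jacobson k := by
      have h2 := hrad a hx a ham
      rw [Ring.jacobson_eq_sInf_isMaximal, Ideal.mem_sInf] at h2 ⊢
      intro I hI
      have := hI.isPrime.mem_or_mem (h2 hI)
      tauto
    have : (Submodule.Quotient.mk a : k ⧸ Ring.jacobson k) = 0 :=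
      (Submodule.Quotient.mk_eq_zero _).2 h1
    rw [this, map_zero]
  obtain ⟨s, t, ht, hst⟩ := hm.exists_inv ha
  refine ⟨b * s, ?_⟩
  rw [← map_smul]
  congr 1
  rw [← Submodule.Quotient.mk_smul, Submodule.Quotient.eq]
  have h1 : (b * s) • a - b = -(t * b) := by
    have : s * a = 1 - t := by rw [← hst]; ring
    rw [smul_eq_mul, mul_assoc, this]; ring
  rw [h1]
  exact neg_mem (hrad b hy t ht)

/-- Every element `m` of a module defines the functional `f ↦ f m` on the dual; on a simple module
all functionals on the dual are of this form. -/
theorem exists_eval_of_isSimpleModule {M : Type*} [AddCommGroup M] [Module k M]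
    [IsSimpleModule k M] (Θ : D k (D k M)) : ∃ m, ∀ f : D k M, Θ f = f m := by
  by_cases h0 : ∃ f : D k M, f ≠ 0
  swap
  · push Not at h0
    exact ⟨0, fun f => by simp [h0 f]⟩
  obtain ⟨f₀, hf₀⟩ := h0
  obtain ⟨m₀, hm₀⟩ : ∃ m, f₀ m ≠ 0 := by
    by_contra h
    push Not at h
    exact hf₀ (LinearMap.ext h)
  set I : Ideal k := Module.annihilator k M with hI
  have hmax : I.IsMaximal := IsSimpleModule.annihilator_isMaximal
  have hann : ∀ (f : D k M) (m : M), ∀ r ∈ I, r • f m = 0 := by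
    intro f m r hr
    rw [← map_smul, Module.mem_annihilator.1 hr m, map_zero]
  have hΘ : ∀ r ∈ I, r • Θ f₀ = 0 := by
    intro r hr
    rw [← map_smul]
    have : r • f₀ = 0 := by
      ext m
      exact hann f₀ m r hr
    rw [this, map_zero]
  obtain ⟨r, hr⟩ := exists_smul_eq_of_maximal I hm₀ (hann f₀ m₀) hΘ
  have hgen : ∀ m : M, ∃ s : k, s • m₀ = m := by
    have hm0 : m₀ ≠ 0 := fun h => hm₀ (by rw [h, map_zero])
    intro m
    have := IsSimpleModule.toSpanSingleton_surjective k hm0 m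
    simpa using this
  refine ⟨r • m₀, fun f => ?_⟩
  -- the dual is generated by `f₀`
  obtain ⟨c, hc⟩ := exists_smul_eq_of_maximal I hm₀ (hann f₀ m₀) (hann f m₀)
  have hf : f = c • f₀ := by
    ext m
    obtain ⟨s, rfl⟩ := hgen m
    rw [map_smul, map_smul, LinearMap.smul_apply, hc]
  rw [hf, map_smul, ← hr, LinearMap.smul_apply, map_smul]

/-- On a module of finite length, every functional on the dual is an evaluation: `M → D (D M)` is
onto. -/
theorem exists_eval_of_isFiniteLength {M : Type w} [AddCommGroup M] [Module k M]
    (hM : IsFiniteLength k M) : ∀ Θ : D k (D k M), ∃ m, ∀ f : D k M, Θ f = f m := by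
  induction hM with
  | of_subsingleton =>
    intro Θ
    refine ⟨0, fun f => ?_⟩
    have : f = 0 := by ext m; rw [Subsingleton.elim m 0, map_zero, map_zero]
    simp [this]
  | @of_simple_quotient M _ _ N hs _ ih =>
    intro Θ
    obtain ⟨q, hq⟩ := exists_eval_of_isSimpleModule (Θ ∘ₗ LinearMap.lcomp k _ N.mkQ)
    obtain ⟨m, rfl⟩ := N.mkQ_surjective q
    -- `Θ - ev m` kills the functionals vanishing on `N`, so it descends to `D N`
    have hkill : ∀ f : D k M, (∀ n : N, f n = 0) → Θ f = f m := by
      intro f hf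
      have h1 := hq (N.liftQ f fun n hn => hf ⟨n, hn⟩)
      have h2 : (LinearMap.lcomp k (minInjCogen k) N.mkQ)
          (N.liftQ f fun n hn => hf ⟨n, hn⟩) = f := rfl
      rw [LinearMap.comp_apply, h2] at h1
      exact h1
    have hres : Function.Surjective (LinearMap.lcomp k (minInjCogen k) N.subtype) := by
      intro g
      obtain ⟨f, hf⟩ := exists_extend_minInjCogen N.subtype N.injective_subtype g
      exact ⟨f, LinearMap.ext hf⟩
    let Θ₁ : D k (D k M) := Θ - LinearMap.applyₗ m
    have hker : LinearMap.ker (LinearMap.lcomp k (minInjCogen k) N.subtype) ≤ LinearMap.ker Θ₁ := by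
      intro f hf
      have : ∀ n : N, f n = 0 := fun n => LinearMap.congr_fun hf n
      simp [Θ₁, hkill f this]
    let Θ₂ : D k (D k N) := (LinearMap.ker _).liftQ Θ₁ hker ∘ₗ
      (LinearMap.quotKerEquivOfSurjective _ hres).symm.toLinearMap
    obtain ⟨n, hn⟩ := ih Θ₂
    refine ⟨m + n, fun f => ?_⟩
    have h1 := hn (f ∘ₗ N.subtype)
    have h2 : Θ₂ (f ∘ₗ N.subtype) = Θ₁ f := by
      have h3 : (LinearMap.quotKerEquivOfSurjective _ hres).symm (f ∘ₗ N.subtype) =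
          Submodule.Quotient.mk f := by
        rw [LinearEquiv.symm_apply_eq]
        rfl
      simp only [Θ₂, LinearMap.comp_apply, LinearEquiv.coe_coe]
      rw [h3]
      rfl
    rw [h2] at h1
    have h4 : Θ f - f m = f n := h1
    rw [map_add, ← h4]
    abel

variable [IsArtinianRing k]

/-- `minInjCogen k` is a cogenerator. -/
theorem exists_dual_ne_zero {M : Type*} [AddCommGroup M] [Module k M] {x : M} (hx : x ≠ 0) :
    ∃ f : D k M, f x ≠ 0 := by
  -- a maximal ideal containing the annihilator of `x`
  have h1 : Ideal.torsionOf k M x ≠ ⊤ := by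
    rw [Ne, Ideal.torsionOf_eq_top_iff]; exact hx
  obtain ⟨m, hm, hle⟩ := Ideal.exists_le_maximal _ h1
  -- as `k / rad k` is semisimple, `k / m` embeds into it
  obtain ⟨a, ha, hma⟩ : ∃ a : k, a ∉ Ring.jacobson k ∧ ∀ r ∈ m, r * a ∈ Ring.jacobson k := by
    have : IsSemisimpleRing (k ⧸ Ring.jacobson k) := inferInstance
    set π := Ideal.Quotient.mk (Ring.jacobson k)
    have hπ : Function.Surjective π := Ideal.Quotient.mk_surjective
    have hker : RingHom.ker π ≤ m := by
      rw [Ideal.mk_ker, Ring.jacobson_eq_sInf_isMaximal]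
      exact sInf_le hm
    obtain ⟨N, hN⟩ := exists_isCompl (m.map π)
    have hmtop : m.map π ≠ ⊤ := by
      intro h
      have := Ideal.comap_map_of_surjective π hπ m
      rw [h, Ideal.comap_top, ← RingHom.ker_eq_comap_bot, sup_eq_left.2 hker] at this
      exact hm.ne_top this.symm
    have hN0 : N ≠ ⊥ := by
      rintro rfl
      exact hmtop (by simpa using hN.sup_eq_top)
    obtain ⟨b, hb, hb0⟩ := Submodule.exists_mem_ne_zero_of_ne_bot hN0
    obtain ⟨a, rfl⟩ := hπ b
    refine ⟨a, fun h => hb0 (Ideal.Quotient.eq_zero_iff_mem.2 h), fun r hr => ?_⟩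
    rw [← Ideal.Quotient.eq_zero_iff_mem]
    have : π (r * a) ∈ m.map π ⊓ N := by
      rw [map_mul]
      exact ⟨Ideal.mul_mem_right _ _ (Ideal.mem_map_of_mem π hr), N.smul_mem _ hb⟩
    rw [hN.inf_eq_bot] at this
    simpa using this
  obtain ⟨-, i, hi, -⟩ := minInjCogen_spec k
  set z : minInjCogen k := i (Submodule.Quotient.mk a) with hz
  have hz0 : z ≠ 0 := by
    rw [hz, Ne, map_eq_zero_iff i hi, Submodule.Quotient.mk_eq_zero]
    exact ha
  have hmz : ∀ r ∈ m, r • z = 0 := by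
    intro r hr
    rw [hz, ← map_smul, map_eq_zero_iff i hi, ← Submodule.Quotient.mk_smul,
      Submodule.Quotient.mk_eq_zero]
    exact hma r hr
  let g₁ : (k ⧸ Ideal.torsionOf k M x) →ₗ[k] minInjCogen k :=
    Submodule.liftQ _ (LinearMap.toSpanSingleton k _ z) fun r hr => hmz r (hle hr)
  let g : D k (Submodule.span k {x}) :=
    g₁ ∘ₗ (Ideal.quotTorsionOfEquivSpanSingleton k M x).symm.toLinearMap
  obtain ⟨f, hf⟩ := exists_extend_minInjCogen (Submodule.subtype _)
    (Submodule.injective_subtype _) g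
  refine ⟨f, ?_⟩
  have h2 := hf ⟨x, Submodule.mem_span_singleton_self x⟩
  have h3 : (Ideal.quotTorsionOfEquivSpanSingleton k M x).symm
      ⟨x, Submodule.mem_span_singleton_self x⟩ = Submodule.Quotient.mk 1 := by
    rw [LinearEquiv.symm_apply_eq]
    apply Subtype.ext
    exact (one_smul k x).symm
  have h4 : g ⟨x, Submodule.mem_span_singleton_self x⟩ = z := by
    simp only [g, LinearMap.comp_apply, LinearEquiv.coe_coe]
    rw [h3]
    exact one_smul k z
  rw [h4] at h2
  intro h
  rw [← h2] at hz0
  exact hz0 h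

/-- Functionals separate points from submodules. -/
theorem exists_dual_separating {M : Type*} [AddCommGroup M] [Module k M] (N : Submodule k M)
    {x : M} (hx : x ∉ N) : ∃ f : D k M, (∀ n ∈ N, f n = 0) ∧ f x ≠ 0 := by
  obtain ⟨f, hf⟩ := exists_dual_ne_zero (k := k) (x := N.mkQ x) (by simpa using hx)
  exact ⟨f ∘ₗ N.mkQ, fun n hn => by simp [(Submodule.Quotient.mk_eq_zero N).2 hn], hf⟩

/-- Elements of a finitely generated module separate functionals from submodules of the dual. -/
theorem exists_separating {M : Type w} [AddCommGroup M] [Module k M] [Module.Finite k M]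
    (N : Submodule k (D k M)) {g : D k M} (hg : g ∉ N) :
    ∃ m : M, (∀ f ∈ N, f m = 0) ∧ g m ≠ 0 := by
  obtain ⟨Θ, hΘN, hΘ⟩ := exists_dual_separating N hg
  have hM : IsFiniteLength k M :=
    isFiniteLength_iff_isNoetherian_isArtinian.2 ⟨inferInstance, inferInstance⟩
  obtain ⟨m, hm⟩ := exists_eval_of_isFiniteLength hM Θ
  exact ⟨m, fun f hf => by rw [← hm, hΘN f hf], by rwa [← hm]⟩

end Duality

/-- An orbit of an algebra acting on an artinian module contains a nonzero element that is killed
by the radical of the algebra. The radical enters through the elements `j` with all `1 - s j`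
units. -/
theorem exists_smul_mem_socle {k V R : Type*} [CommRing k] [AddCommGroup V] [Module k V]
    [IsArtinian k V] [Ring R] [Algebra k R] (ρ : R →ₐ[k] Module.End k V) {v : V} (hv : v ≠ 0) :
    ∃ r : R, ρ r v ≠ 0 ∧ ∀ j : R, (∀ s : R, IsUnit (1 - s * j)) → ρ j (ρ r v) = 0 := by
  -- the orbit of `ρ r v`
  let O : R → Submodule k V := fun r =>
    LinearMap.range (LinearMap.applyₗ (ρ r v) ∘ₗ ρ.toLinearMap)
  have hO : ∀ r x, x ∈ O r ↔ ∃ s, ρ s (ρ r v) = x := fun r x => Iff.rfl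
  obtain ⟨N, ⟨r, hr, rfl⟩, hmin⟩ := IsArtinian.set_has_minimal {N | ∃ r, ρ r v ≠ 0 ∧ O r = N}
    ⟨O 1, 1, by simpa using hv, rfl⟩
  refine ⟨r, hr, fun j hj => ?_⟩
  by_contra hne
  have hmul : ∀ a b : R, ρ a (ρ b v) = ρ (a * b) v := fun a b => by
    rw [map_mul]; rfl
  have hle : O (j * r) ≤ O r := by
    intro x hx
    obtain ⟨s, rfl⟩ := (hO _ _).1 hx
    exact (hO _ _).2 ⟨s * j, by rw [hmul, hmul, mul_assoc]⟩
  have hge : O r ≤ O (j * r) := by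
    by_contra h
    exact hmin _ ⟨j * r, by rwa [← hmul], rfl⟩ (lt_of_le_not_ge hle h)
  obtain ⟨s, hs⟩ := (hO _ _).1 (hge ((hO _ (ρ r v)).2 ⟨1, by rw [map_one]; rfl⟩))
  obtain ⟨u, hu⟩ := hj s
  have h0 : ρ (1 - s * j) (ρ r v) = 0 := by
    rw [map_sub, map_one, LinearMap.sub_apply, Module.End.one_apply, sub_eq_zero, hmul, mul_assoc,
      ← hmul, hs]
  apply hr
  have : ρ (↑u⁻¹ * (1 - s * j)) (ρ r v) = 0 := by
    rw [map_mul, Module.End.mul_apply, h0, map_zero]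
  rwa [← hu, Units.inv_mul, map_one] at this

/-! ### Local endomorphism rings and the radical -/

section Local

variable {C : Type t} [Category.{v} C]

theorem isSplitEpi_of_isIso_comp {A T : C} (m : A ⟶ T) (h : T ⟶ A) [IsIso (m ≫ h)] :
    IsSplitEpi h :=
  ⟨⟨⟨inv (m ≫ h) ≫ m, by rw [Category.assoc, IsIso.inv_hom_id]⟩⟩⟩

theorem isSplitMono_of_isIso_comp {A T : C} (h : A ⟶ T) (m : T ⟶ A) [IsIso (h ≫ m)] :
    IsSplitMono h :=
  ⟨⟨⟨m ≫ inv (h ≫ m), by rw [← Category.assoc, IsIso.hom_inv_id]⟩⟩⟩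

/-- Left determinedness is invariant under left equivalence. -/
theorem LeftDetermined.of_leftEquivalent {A B B' K : C} {f : A ⟶ B} {g : A ⟶ B'}
    (h : LeftEquivalent f g) (hf : LeftDetermined K f) : LeftDetermined K g := by
  have trans : ∀ {P Q R : C} {a : A ⟶ P} {b : A ⟶ Q} {c : A ⟶ R},
      CofactorsThrough a b → CofactorsThrough b c → CofactorsThrough a c := by
    rintro P Q R a b c ⟨s, rfl⟩ ⟨r, rfl⟩
    exact ⟨r ≫ s, by rw [Category.assoc]⟩
  intro T a ha
  exact trans (hf a fun e => trans (ha e) h.2) h.1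

variable [Preadditive C]

theorem isIso_one_sub_comm {A B : C} (f : A ⟶ B) (g : B ⟶ A) (h : IsIso (𝟙 A - f ≫ g)) :
    IsIso (𝟙 B - g ≫ f) := by
  obtain ⟨i, h1, h2⟩ := h
  simp only [Preadditive.sub_comp, Preadditive.comp_sub, Category.id_comp, Category.comp_id,
    Category.assoc, sub_eq_iff_eq_add] at h1 h2
  -- `(1 - gf)⁻¹ = 1 + g (1 - fg)⁻¹ f`
  refine ⟨𝟙 B + g ≫ i ≫ f, ?_, ?_⟩
  · simp only [Preadditive.sub_comp, Preadditive.comp_add, Category.id_comp, Category.comp_id,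
      Category.assoc]
    have : g ≫ i ≫ f = g ≫ f + g ≫ f ≫ g ≫ i ≫ f := by
      conv_lhs => rw [h1]
      simp
    nth_rewrite 1 [this]
    abel
  · simp only [Preadditive.comp_sub, Preadditive.add_comp, Category.id_comp, Category.comp_id,
      Category.assoc]
    have : g ≫ i ≫ f = g ≫ f + g ≫ i ≫ f ≫ g ≫ f := by
      conv_lhs => rw [h2]
      simp
    nth_rewrite 1 [this]
    abel

theorem isIso_or_isIso_one_sub {A : C} [IsLocalRing (End A)] (u : A ⟶ A) :
    IsIso u ∨ IsIso (𝟙 A - u) := by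
  rw [← isUnit_iff_isIso, ← isUnit_iff_isIso]
  exact IsLocalRing.isUnit_or_isUnit_of_add_one
    (show (show End A from u) + (show End A from (𝟙 A - u)) = 1 from add_sub_cancel _ _)

theorem isIso_one_sub_comp_of_not_isSplitEpi {A T : C} [IsLocalRing (End A)] (m : A ⟶ T)
    {h : T ⟶ A} (hh : ¬ IsSplitEpi h) : IsIso (𝟙 A - m ≫ h) := by
  rcases isIso_or_isIso_one_sub (m ≫ h) with h1 | h1
  · exact (hh (isSplitEpi_of_isIso_comp m h)).elim
  · exact h1

theorem isIso_one_sub_comp_of_not_isSplitMono {A T : C} [IsLocalRing (End A)] {h : A ⟶ T}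
    (hh : ¬ IsSplitMono h) (m : T ⟶ A) : IsIso (𝟙 A - h ≫ m) := by
  rcases isIso_or_isIso_one_sub (h ≫ m) with h1 | h1
  · exact (hh (isSplitMono_of_isIso_comp h m)).elim
  · exact h1

theorem id_ne_zero_of_isLocalRing (A : C) [IsLocalRing (End A)] : 𝟙 A ≠ 0 :=
  fun h => one_ne_zero (α := End A) h

theorem mem_jacobson_of_isUnit_one_sub {R : Type*} [Ring R] {x : R}
    (h : ∀ s, IsUnit (1 - s * x)) : x ∈ Ring.jacobson R := by
  rw [← Ideal.jacobson_bot, Ideal.mem_jacobson_iff]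
  intro y
  obtain ⟨u, hu⟩ := h (-y)
  refine ⟨↑u⁻¹, ?_⟩
  have : (↑u⁻¹ : R) * y * x + ↑u⁻¹ = ↑u⁻¹ * (1 - -y * x) := by noncomm_ring
  rw [this, ← hu, Units.inv_mul, sub_self]
  exact Submodule.zero_mem _

/-- Over an object with local endomorphism ring, the non-retractions are radical morphisms. -/
theorem inRadical_of_not_isSplitEpi {A T : C} [IsLocalRing (End A)] {h : T ⟶ A}
    (hh : ¬ IsSplitEpi h) : InRadical h := by
  intro W g e
  refine mem_jacobson_of_isUnit_one_sub fun s => ?_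
  rw [isUnit_iff_isIso]
  have h2 := isIso_one_sub_comp_of_not_isSplitEpi ((e ≫ (show W ⟶ W from s)) ≫ g) hh
  rw [Category.assoc] at h2
  have h3 := isIso_one_sub_comm _ _ h2
  simp only [Category.assoc] at h3
  simpa only [End.mul_def, End.one_def, Category.assoc] using h3

theorem not_isSplitEpi_of_mem_jacobson {A : C} [IsLocalRing (End A)] {j : End A}
    (hj : j ∈ Ring.jacobson (End A)) : ¬ IsSplitEpi (show A ⟶ A from j) := by
  rintro ⟨⟨s, hs⟩⟩
  have h1 : (1 : End A) ∈ Ring.jacobson (End A) := by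
    have : j * (show End A from s) = 1 := hs
    rw [← this]
    exact Ideal.mul_mem_right _ _ hj
  rw [← Ideal.jacobson_bot, Ideal.mem_jacobson_iff] at h1
  obtain ⟨z, hz⟩ := h1 (-1)
  rw [mul_one, mul_neg, mul_one, neg_add_cancel, zero_sub, Ideal.mem_bot, neg_eq_zero] at hz
  exact one_ne_zero hz

theorem sum_comp_eq_id_of_iso_biproduct [HasFiniteBiproducts C] {n : ℕ} {F : Fin n → C} {Z : C}
    (e : Z ≅ ⨁ F) : ∑ j, (e.hom ≫ biproduct.π F j) ≫ biproduct.ι F j ≫ e.inv = 𝟙 Z := by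
  have h : ∑ j, (e.hom ≫ biproduct.π F j) ≫ biproduct.ι F j ≫ e.inv =
      e.hom ≫ (∑ j, biproduct.π F j ≫ biproduct.ι F j) ≫ e.inv := by
    simp only [Preadditive.comp_sum, Preadditive.sum_comp, Category.assoc]
  rw [h, biproduct.total, Category.id_comp, e.hom_inv_id]

/-- In a Krull-Schmidt category, indecomposable objects have local endomorphism rings. -/
theorem isLocalRing_end_of_indecomposable [HasFiniteBiproducts C] [HasBinaryBiproducts C]
    (hKS : KrullSchmidt C) {Z : C} (hZ : Indecomposable Z) : IsLocalRing (End Z) := by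
  classical
  obtain ⟨n, F, hF, ⟨e⟩⟩ := hKS Z
  cases n with
  | zero =>
    refine (hZ.1 ?_).elim
    rw [IsZero.iff_id_eq_zero, ← cancel_mono e.hom]
    exact biproduct.hom_ext _ _ fun j => j.elim0
  | succ n =>
    -- a complement of the first summand
    obtain ⟨R, q, i, htot, hiq⟩ : ∃ (R : C) (q : ⨁ F ⟶ R) (i : R ⟶ ⨁ F),
        biproduct.π F 0 ≫ biproduct.ι F 0 + q ≫ i = 𝟙 _ ∧ i ≫ q = 𝟙 R := by
      refine ⟨_, biproduct.toSubtype F (· ≠ 0), biproduct.fromSubtype F (· ≠ 0), ?_,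
        biproduct.fromSubtype_toSubtype F _⟩
      rw [biproduct.toSubtype_fromSubtype]
      refine biproduct.hom_ext' _ _ fun i => biproduct.hom_ext _ _ fun j => ?_
      by_cases hi : i = 0
      · subst hi
        simp
      · simp [hi]
    have h1 : biproduct.ι F 0 ≫ q = 0 := by
      have := biproduct.ι F 0 ≫= htot =≫ q
      simpa [hiq] using this
    have h2 : i ≫ biproduct.π F 0 = 0 := by
      have := i ≫= htot =≫ biproduct.π F 0
      simpa [reassoc_of% hiq] using this
    let e' : ⨁ F ≅ F 0 ⊞ R :=
      { hom := biprod.lift (biproduct.π F 0) q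
        inv := biprod.desc (biproduct.ι F 0) i
        hom_inv_id := by rw [biprod.lift_desc, htot]
        inv_hom_id := by
          apply biprod.hom_ext' <;> apply biprod.hom_ext <;> simp [h1, h2, hiq] }
    have := hF 0
    rcases hZ.2 _ _ (e ≪≫ e') with h | h
    · exact (id_ne_zero_of_isLocalRing (F 0) (h.eq_of_src _ _)).elim
    · have e'' : Z ≅ F 0 := e ≪≫ e' ≪≫
        { hom := biprod.fst
          inv := biprod.inl
          hom_inv_id := by
            apply biprod.hom_ext'
            · simp
            · exact h.eq_of_src _ _
          inv_hom_id := by simp }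
      -- conjugation by an isomorphism identifies the endomorphism rings
      have hconj : ∀ u : End Z, IsIso (e''.inv ≫ u ≫ e''.hom) → IsUnit u := by
        intro u hu
        rw [isUnit_iff_isIso]
        have : u = e''.hom ≫ (e''.inv ≫ u ≫ e''.hom) ≫ e''.inv := by simp
        rw [this]
        infer_instance
      have : Nontrivial (End Z) := ⟨⟨1, 0, fun h => hZ.1 ((IsZero.iff_id_eq_zero Z).2 h)⟩⟩
      refine ⟨fun {a b} hab => ?_⟩
      rcases isIso_or_isIso_one_sub (e''.inv ≫ a ≫ e''.hom) with h | h
      · exact Or.inl (hconj a h)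
      · refine Or.inr (hconj b ?_)
        have h3 : 𝟙 _ - e''.inv ≫ a ≫ e''.hom = e''.inv ≫ b ≫ e''.hom := by
          have : b = 1 - a := eq_sub_of_add_eq' hab
          rw [this]
          change _ = e''.inv ≫ (𝟙 Z - (show Z ⟶ Z from a)) ≫ e''.hom
          simp
        rwa [← h3]

end Local

/-! ### Exact sequences of a triangle -/

section Triangles

namespace LinearExtriangulated

variable {k : Type u} [CommRing k] {C : Type t} [Category.{v} C]

section Bifunctor

variable {E : Cᵒᵖ ⥤ C ⥤ ModuleCat.{w} k}

theorem push_comp {Z A A' A'' : C} (a : A ⟶ A') (b : A' ⟶ A'') (δ : Extn E Z A) :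
    push (a ≫ b) δ = push b (push a δ) := by
  simp [push]

theorem pull_comp {Z Z' Z'' A : C} (c : Z' ⟶ Z) (d : Z'' ⟶ Z') (δ : Extn E Z A) :
    pull (d ≫ c) δ = pull d (pull c δ) := by
  simp [pull]

theorem push_id {Z A : C} (δ : Extn E Z A) : push (𝟙 A) δ = δ := by
  simp [push]

theorem pull_id {Z A : C} (δ : Extn E Z A) : pull (𝟙 Z) δ = δ := by
  simp [pull]

theorem push_pull {Z Z' A A' : C} (a : A ⟶ A') (c : Z' ⟶ Z) (δ : Extn E Z A) :
    push a (pull c δ) = pull c (push a δ) := by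
  have := (E.map c.op).naturality a
  exact (LinearMap.congr_fun (congrArg ModuleCat.Hom.hom this) δ).symm

end Bifunctor

variable [Preadditive C] [Linear k C]
  [HasFiniteBiproducts C] [HasBinaryBiproducts C]
  (X : LinearExtriangulated.{u, v, t, w} k C)

theorem push_zero_hom {Z A A' : C} (δ : Extn X.E Z A) : push (0 : A ⟶ A') δ = 0 := by
  simpa using X.bilinear.push_smul (0 : k) (0 : A ⟶ A') δ

theorem pull_zero_hom {Z Z' A : C} (δ : Extn X.E Z A) : pull (0 : Z' ⟶ Z) δ = 0 := by
  simpa using X.bilinear.pull_smul (0 : k) (0 : Z' ⟶ Z) δ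

theorem push_sub_hom {Z A A' : C} (a b : A ⟶ A') (δ : Extn X.E Z A) :
    push (a - b) δ = push a δ - push b δ := by
  rw [eq_sub_iff_add_eq, ← X.bilinear.push_add, sub_add_cancel]

theorem pull_sub_hom {Z Z' A : C} (c d : Z' ⟶ Z) (δ : Extn X.E Z A) :
    pull (c - d) δ = pull c δ - pull d δ := by
  rw [eq_sub_iff_add_eq, ← X.bilinear.pull_add, sub_add_cancel]

theorem push_sum {ι : Type*} (s : Finset ι) {Z A A' : C} (a : ι → (A ⟶ A')) (δ : Extn X.E Z A) :
    push (∑ i ∈ s, a i) δ = ∑ i ∈ s, push (a i) δ := by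
  classical
  induction s using Finset.induction_on with
  | empty => simp [X.push_zero_hom]
  | insert i s hi ih => rw [Finset.sum_insert hi, Finset.sum_insert hi, X.bilinear.push_add, ih]

theorem pull_sum {ι : Type*} (s : Finset ι) {Z Z' A : C} (c : ι → (Z' ⟶ Z)) (δ : Extn X.E Z A) :
    pull (∑ i ∈ s, c i) δ = ∑ i ∈ s, pull (c i) δ := by
  classical
  induction s using Finset.induction_on with
  | empty => simp [X.pull_zero_hom]
  | insert i s hi ih => rw [Finset.sum_insert hi, Finset.sum_insert hi, X.bilinear.pull_add, ih]

theorem exists_isTriangle {Z A : C} (δ : Extn X.E Z A) :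
    ∃ (B : C) (x : A ⟶ B) (y : B ⟶ Z), X.IsTriangle x y δ := by
  obtain ⟨⟨B, x, y⟩, h⟩ := Quotient.exists_rep (X.s δ)
  exact ⟨B, x, y, h.symm⟩

variable {X} {A B Z : C} {x : A ⟶ B} {y : B ⟶ Z} {δ : Extn X.E Z A}

/-- Exactness of `C(B, W) → C(A, W) → E(Z, W)`. -/
theorem IsTriangle.cofactorsThrough_iff (h : X.IsTriangle x y δ) {W : C} (f : A ⟶ W) :
    CofactorsThrough f x ↔ push f δ = 0 := by
  constructor
  · rintro ⟨s, rfl⟩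
    -- compare with the split triangle on `0 ∈ E(Z, B)`
    obtain ⟨c, -, hc⟩ := X.et3 x y _ _ δ 0 h (X.s_zero Z B) x biprod.inl rfl
    rw [push_comp, hc, map_zero, map_zero]
  · intro hf
    obtain ⟨b, hb, -⟩ := X.realization x y _ _ δ 0 h (X.s_zero Z W) f (𝟙 Z) (by rw [hf, map_zero])
    exact ⟨b ≫ biprod.fst, by rw [← Category.assoc, hb]; simp⟩

/-- Exactness of `C(W, B) → C(W, Z) → E(W, A)`. -/
theorem IsTriangle.factorsThrough_iff (h : X.IsTriangle x y δ) {W : C} (f : W ⟶ Z) :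
    FactorsThrough f y ↔ pull f δ = 0 := by
  constructor
  · rintro ⟨s, rfl⟩
    obtain ⟨a, -, ha⟩ := X.et3_op _ _ x y 0 δ (X.s_zero B A) h biprod.snd y rfl
    rw [pull_comp, ← ha, map_zero, map_zero]
  · intro hf
    obtain ⟨b, -, hb⟩ := X.realization _ _ x y 0 δ (X.s_zero W A) h (𝟙 A) f (by rw [hf, map_zero])
    exact ⟨biprod.inr ≫ b, by rw [Category.assoc, ← hb]; simp⟩

theorem IsTriangle.comp_eq_zero (h : X.IsTriangle x y δ) : x ≫ y = 0 := by
  obtain ⟨b, hb, hb'⟩ := X.realization _ _ x y 0 δ (X.s_zero A A) h (𝟙 A) 0 (by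
    rw [map_zero, X.pull_zero_hom])
  have := congrArg (biprod.inl ≫ ·) hb'
  simp only [comp_zero, ← Category.assoc, hb] at this
  rw [this, Category.id_comp]

/-- Exactness of `C(W, A) → C(W, B) → C(W, Z)`. -/
theorem IsTriangle.factorsThrough_of_comp_eq_zero (h : X.IsTriangle x y δ) {W : C} {f : W ⟶ B}
    (hf : f ≫ y = 0) : FactorsThrough f x := by
  obtain ⟨a, ha, -⟩ := X.et3_op _ _ x y 0 δ (X.s_zero W W) h (biprod.fst ≫ f) 0 (by simp [hf])
  exact ⟨a, by simpa using ha.symm⟩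

/-- Exactness of `C(Z, W) → C(B, W) → C(A, W)`. -/
theorem IsTriangle.cofactorsThrough_of_comp_eq_zero (h : X.IsTriangle x y δ) {W : C} {f : B ⟶ W}
    (hf : x ≫ f = 0) : CofactorsThrough f y := by
  obtain ⟨c, hc, -⟩ := X.et3 x y _ _ δ 0 h (X.s_zero W W) 0 (f ≫ biprod.inr) (by
    rw [← Category.assoc, hf, zero_comp, zero_comp])
  exact ⟨c, by rw [hc]; simp⟩

/-- Exactness of `C(W, Z) → E(W, A) → E(W, B)`. -/
theorem IsTriangle.exists_pull_eq (h : X.IsTriangle x y δ) {W : C} {η : Extn X.E W A}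
    (hη : push x η = 0) : ∃ c : W ⟶ Z, pull c δ = η := by
  obtain ⟨B', x', y', h'⟩ := X.exists_isTriangle η
  obtain ⟨v, hv⟩ := (h'.cofactorsThrough_iff x).2 hη
  obtain ⟨c, -, hc⟩ := X.et3 x' y' x y η δ h' h (𝟙 A) v (by rw [hv, Category.id_comp])
  exact ⟨c, by rw [← hc, push_id]⟩

/-- Exactness of `C(A, W) → E(Z, W) → E(B, W)`. -/
theorem IsTriangle.exists_push_eq (h : X.IsTriangle x y δ) {W : C} {η : Extn X.E Z W}
    (hη : pull y η = 0) : ∃ a : A ⟶ W, push a δ = η := by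
  obtain ⟨B', x', y', h'⟩ := X.exists_isTriangle η
  obtain ⟨v, hv⟩ := (h'.factorsThrough_iff y).2 hη
  obtain ⟨a, -, ha⟩ := X.et3_op x y x' y' δ η h h' v (𝟙 Z) (by rw [hv, Category.comp_id])
  exact ⟨a, by rw [ha, pull_id]⟩

theorem IsTriangle.isSplitEpi_iff (h : X.IsTriangle x y δ) : IsSplitEpi y ↔ δ = 0 := by
  rw [← pull_id δ, ← h.factorsThrough_iff]
  exact ⟨fun ⟨⟨s, hs⟩⟩ => ⟨s, hs⟩, fun ⟨s, hs⟩ => ⟨⟨s, hs⟩⟩⟩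

theorem IsTriangle.isSplitMono_iff (h : X.IsTriangle x y δ) : IsSplitMono x ↔ δ = 0 := by
  rw [← push_id δ, ← h.cofactorsThrough_iff]
  exact ⟨fun ⟨⟨s, hs⟩⟩ => ⟨s, hs⟩, fun ⟨s, hs⟩ => ⟨⟨s, hs⟩⟩⟩

/-- A five lemma for endomorphisms of a triangle that are the identity on the left. -/
theorem IsTriangle.isIso_of_isIso (h : X.IsTriangle x y δ) {u : B ⟶ B} {c : Z ⟶ Z}
    (hu : x ≫ u = x) (hc : y ≫ c = u ≫ y) (hδ : pull c δ = δ) [IsIso c] : IsIso u := by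
  have hinv : pull (inv c) δ = δ := by
    conv_lhs => rw [← hδ]
    rw [← pull_comp, IsIso.inv_hom_id, pull_id]
  have h1 : IsSplitEpi u := by
    obtain ⟨β, hβ⟩ := (h.factorsThrough_iff (y ≫ inv c)).2 (by
      rw [pull_comp, hinv, ← h.factorsThrough_iff]; exact ⟨𝟙 B, Category.id_comp y⟩)
    obtain ⟨a, ha⟩ := h.factorsThrough_of_comp_eq_zero (f := 𝟙 B - β ≫ u) (by
      rw [Preadditive.sub_comp, Category.assoc, ← hc, ← Category.assoc, hβ]; simp)
    refine ⟨⟨β + a ≫ x, ?_⟩⟩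
    rw [Preadditive.add_comp, Category.assoc, hu, ha, add_sub_cancel]
  have h2 : IsSplitMono u := by
    obtain ⟨γ, hγ⟩ := h.cofactorsThrough_of_comp_eq_zero (f := 𝟙 B - u) (by
      rw [Preadditive.comp_sub, hu, Category.comp_id, sub_self])
    refine ⟨⟨𝟙 B + y ≫ inv c ≫ γ, ?_⟩⟩
    rw [Preadditive.comp_add, ← Category.assoc u y, ← hc, Category.assoc, IsIso.hom_inv_id_assoc,
      hγ]
    simp
  exact isIso_of_mono_of_isSplitEpi u

end LinearExtriangulated

end Triangles

namespace LinearExtriangulated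

variable {k : Type u} [CommRing k] {C : Type t} [Category.{v} C] [Preadditive C] [Linear k C]
  [HasFiniteBiproducts C] [HasBinaryBiproducts C] {X : LinearExtriangulated.{u, v, t, w} k C}

/-! ### Almost split extensions -/

theorem ProjObj.of_isSplitEpi {Z W : C} {f : Z ⟶ W} (hf : X.ProjMor f) [IsSplitEpi f] :
    X.ProjObj W := by
  intro A δ
  rw [← IsSplitEpi.id f, pull_comp, hf, map_zero]

/-- A nonzero extension stays nonzero after projecting to some summand of its first term. -/
theorem exists_local_push_ne_zero (hKS : KrullSchmidt C) {Z A : C} {δ : Extn X.E Z A}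
    (hδ : δ ≠ 0) : ∃ (A' : C) (a : A ⟶ A'), IsLocalRing (End A') ∧ push a δ ≠ 0 := by
  obtain ⟨n, F, hF, ⟨e⟩⟩ := hKS A
  by_contra! h
  apply hδ
  rw [← push_id δ, ← sum_comp_eq_id_of_iso_biproduct e, X.push_sum]
  refine Finset.sum_eq_zero fun j _ => ?_
  rw [push_comp, h _ _ (hF j), map_zero]

/-- If the first term has local endomorphism ring, the condition on retractions alone makes an
extension almost split. -/
theorem AlmostSplit.of_pull_eq_zero {Z A : C} [IsLocalRing (End A)] {δ : Extn X.E Z A}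
    (hδ : δ ≠ 0) (h : ∀ ⦃Z' : C⦄ (c : Z' ⟶ Z), ¬ IsSplitEpi c → pull c δ = 0) :
    X.AlmostSplit δ := by
  refine ⟨hδ, fun A' a ha => ?_, h⟩
  by_contra hne
  obtain ⟨B, x, y, hT⟩ := X.exists_isTriangle (push a δ)
  obtain ⟨b, hb⟩ := hT.exists_push_eq (h y fun hy => hne (hT.isSplitEpi_iff.1 hy))
  -- now `b_⋆ a_⋆ δ = δ`, while `1 - a ≫ b` is invertible
  have h1 := isIso_one_sub_comp_of_not_isSplitMono ha b
  have h2 : push (𝟙 A - a ≫ b) δ = 0 := by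
    rw [X.push_sub_hom, push_id, push_comp, hb, sub_self]
  apply hδ
  rw [← push_id δ, ← IsIso.hom_inv_id (𝟙 A - a ≫ b), push_comp, h2, map_zero]

/-- If the last term has local endomorphism ring, the condition on sections alone makes an
extension almost split. -/
theorem AlmostSplit.of_push_eq_zero {Z A : C} [IsLocalRing (End Z)] {δ : Extn X.E Z A}
    (hδ : δ ≠ 0) (h : ∀ ⦃A' : C⦄ (a : A ⟶ A'), ¬ IsSplitMono a → push a δ = 0) :
    X.AlmostSplit δ := by
  refine ⟨hδ, h, fun Z' c hc => ?_⟩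
  by_contra hne
  obtain ⟨B, x, y, hT⟩ := X.exists_isTriangle (pull c δ)
  obtain ⟨b, hb⟩ := hT.exists_pull_eq (h x fun hx => hne (hT.isSplitMono_iff.1 hx))
  have h1 := isIso_one_sub_comp_of_not_isSplitEpi b hc
  have h2 : pull (𝟙 Z - b ≫ c) δ = 0 := by
    rw [X.pull_sub_hom, pull_id, pull_comp, hb, sub_self]
  apply hδ
  rw [← pull_id δ, ← IsIso.inv_hom_id (𝟙 Z - b ≫ c), pull_comp, h2, map_zero]

/-- A nonzero extension killed by all non-retractions yields an almost split one by projecting to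
a summand of the first term. -/
theorem exists_almostSplit_of_pull_eq_zero (hKS : KrullSchmidt C) {Z A : C} {δ : Extn X.E Z A}
    (hδ : δ ≠ 0) (h : ∀ ⦃Z' : C⦄ (c : Z' ⟶ Z), ¬ IsSplitEpi c → pull c δ = 0) :
    ∃ (A' : C) (δ' : Extn X.E Z A'), X.AlmostSplit δ' := by
  obtain ⟨A', a, hA', ha⟩ := exists_local_push_ne_zero hKS hδ
  exact ⟨A', push a δ, .of_pull_eq_zero ha fun Z' c hc => by rw [← push_pull, h c hc, map_zero]⟩

section AlmostSplitTriangle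

variable {A B Z : C} {x : A ⟶ B} {y : B ⟶ Z} {δ : Extn X.E Z A}

theorem AlmostSplit.rightDetermined (h : X.AlmostSplit δ) (hT : X.IsTriangle x y δ) :
    RightDetermined Z y := by
  intro T g hg
  rw [hT.factorsThrough_iff]
  refine h.2.2 g ?_
  rintro ⟨⟨s, hs⟩⟩
  have := hg s
  rw [hs, hT.factorsThrough_iff, pull_id] at this
  exact h.1 this

theorem AlmostSplit.leftDetermined (h : X.AlmostSplit δ) (hT : X.IsTriangle x y δ) :
    LeftDetermined A x := by
  intro T g hg
  rw [hT.cofactorsThrough_iff]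
  refine h.2.1 g ?_
  rintro ⟨⟨s, hs⟩⟩
  have := hg s
  rw [hs, hT.cofactorsThrough_iff, push_id] at this
  exact h.1 this

theorem IsTriangle.leftMinimal [IsLocalRing (End Z)] (hT : X.IsTriangle x y δ) (hδ : δ ≠ 0) :
    LeftMinimal x := by
  intro g hg
  obtain ⟨c, hc, hc'⟩ := X.et3 x y x y δ δ hT hT (𝟙 A) g (by rw [hg, Category.id_comp])
  rw [push_id] at hc'
  rcases isIso_or_isIso_one_sub c with h | h
  · exact hT.isIso_of_isIso hg hc hc'.symm
  · -- `1 - c` kills `δ`, so it is not invertible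
    have h1 : pull (𝟙 Z - c) δ = 0 := by rw [X.pull_sub_hom, pull_id, ← hc', sub_self]
    refine (hδ ?_).elim
    rw [← pull_id δ, ← IsIso.inv_hom_id (𝟙 Z - c), pull_comp, h1, map_zero]

/-- A triangle with left minimal first map and nonzero last term does not split. -/
theorem IsTriangle.ne_zero_of_leftMinimal (hT : X.IsTriangle x y δ) (hx : LeftMinimal x)
    (hZ : ¬ IsZero Z) : δ ≠ 0 := by
  intro hδ
  obtain ⟨⟨r, hr⟩⟩ := hT.isSplitMono_iff.2 hδ
  obtain ⟨⟨s, hs⟩⟩ := hT.isSplitEpi_iff.2 hδ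
  -- the idempotent `r ≫ x` is invertible, hence `x` is epi and `y = 0`
  have h1 : IsIso (r ≫ x) := hx _ (by rw [← Category.assoc, hr, Category.id_comp])
  have h4 : y = 0 := by
    rw [← cancel_epi (r ≫ x), Category.assoc, hT.comp_eq_zero, comp_zero, comp_zero]
  apply hZ
  rw [IsZero.iff_id_eq_zero, ← hs, h4, comp_zero]

end AlmostSplitTriangle

/-! ### Representability of `D E(Z, -)` -/

variable (X) in
/-- The functional `Φ` on `E(Z, T)` is a universal element of `D E(Z, -)`, as a functor on the
costable category: every functional on `E(Z, M)` has the form `μ ↦ Φ (g_⋆ μ)`, for a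
morphism `g : M ⟶ T` that is unique up to `s`-injective morphisms. -/
def IsUniversal {Z T : C} (Φ : D k (Extn X.E Z T)) : Prop :=
  (∀ ⦃M : C⦄ (Ψ : D k (Extn X.E Z M)), ∃ g : M ⟶ T, ∀ μ, Φ (push g μ) = Ψ μ) ∧
    ∀ ⦃M : C⦄ (g : M ⟶ T), (∀ μ : Extn X.E Z M, Φ (push g μ) = 0) → g ∈ X.injMor M T

variable (X) in
/-- For an extension of `Z` by `M`, the pairing with morphisms `M ⟶ T` given by `Φ`. -/
noncomputable def pairing {Z T : C} (Φ : D k (Extn X.E Z T)) (M : C) :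
    (M ⟶ T) →ₗ[k] D k (Extn X.E Z M) where
  toFun g := Φ ∘ₗ push g
  map_add' g g' := by
    ext μ
    simp [X.bilinear.push_add]
  map_smul' r g := by
    ext μ
    simp [X.bilinear.push_smul]

theorem pairing_apply {Z T : C} (Φ : D k (Extn X.E Z T)) {M : C} (g : M ⟶ T) (μ : Extn X.E Z M) :
    X.pairing Φ M g μ = Φ (push g μ) := rfl

/-- Yoneda: `D E(Z, -)` is representable if and only if it has a universal element. -/
theorem memCr_iff_exists_isUniversal {Z : C} :
    X.MemCr Z ↔ ∃ (T : C) (Φ : D k (Extn X.E Z T)), X.IsUniversal Φ := by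
  constructor
  · rintro ⟨T, φ, hφ⟩
    have key : ∀ (M : C) (g : M ⟶ T) (μ : Extn X.E Z M),
        φ T ((X.injMor T T).mkQ (𝟙 T)) (push g μ) = φ M ((X.injMor M T).mkQ g) μ := by
      intro M g μ
      rw [← hφ, Category.comp_id]
    refine ⟨T, φ T ((X.injMor T T).mkQ (𝟙 T)), fun M Ψ => ?_, fun M g hg => ?_⟩
    · obtain ⟨g, hg⟩ := (X.injMor M T).mkQ_surjective ((φ M).symm Ψ)
      refine ⟨g, fun μ => ?_⟩
      rw [key, hg, LinearEquiv.apply_symm_apply]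
    · have h1 : φ M ((X.injMor M T).mkQ g) = 0 := by
        ext μ
        rw [← key, hg]
        rfl
      rw [LinearEquiv.map_eq_zero_iff] at h1
      simpa using h1
  · rintro ⟨T, Φ, hsurj, hinj⟩
    have hker : ∀ M, X.injMor M T ≤ LinearMap.ker (X.pairing Φ M) := by
      intro M g hg
      rw [LinearMap.mem_ker]
      ext μ
      rw [pairing_apply, hg, map_zero]
      rfl
    refine ⟨T, fun M => LinearEquiv.ofBijective ((X.injMor M T).liftQ _ (hker M)) ⟨?_, ?_⟩, ?_⟩
    · rw [← LinearMap.ker_eq_bot, Submodule.ker_liftQ_eq_bot]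
      intro g hg
      exact hinj g fun μ => LinearMap.congr_fun hg μ
    · intro Ψ
      obtain ⟨g, hg⟩ := hsurj Ψ
      exact ⟨(X.injMor M T).mkQ g, LinearMap.ext hg⟩
    · intro M' M f g μ
      exact congrArg Φ (push_comp f g μ)

/-- An extension by the representing object vanishes if `Φ` vanishes on all its pullbacks
to `Z`. -/
theorem IsUniversal.eq_zero_of_pull {Z T : C} {Φ : D k (Extn X.E Z T)} (hΦ : X.IsUniversal Φ)
    {Y : C} {ξ : Extn X.E Y T} (h : ∀ f : Z ⟶ Y, Φ (pull f ξ) = 0) : ξ = 0 := by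
  obtain ⟨B, x, y, hT⟩ := X.exists_isTriangle ξ
  -- `Φ` vanishes on the kernel of `x_⋆`, so it extends along `x_⋆`
  have hker : LinearMap.ker (push x : Extn X.E Z T →ₗ[k] Extn X.E Z B) ≤ LinearMap.ker Φ := by
    intro η hη
    obtain ⟨f, rfl⟩ := hT.exists_pull_eq hη
    exact h f
  obtain ⟨Ψ, hΨ⟩ := exists_extend_minInjCogen
    ((LinearMap.ker (push x : Extn X.E Z T →ₗ[k] Extn X.E Z B)).liftQ (push x) le_rfl)
    (by rw [← LinearMap.ker_eq_bot, Submodule.ker_liftQ_eq_bot _ _ _ le_rfl])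
    (Submodule.liftQ _ Φ hker)
  have hΨ' : ∀ η : Extn X.E Z T, Ψ (push x η) = Φ η := fun η =>
    hΨ (Submodule.Quotient.mk η)
  obtain ⟨g, hg⟩ := hΦ.1 Ψ
  -- the extension is represented by `x ≫ g`, so `x ≫ g` acts on extensions as the identity
  have h1 : 𝟙 T - x ≫ g ∈ X.injMor T T := hΦ.2 _ fun μ => by
    rw [X.push_sub_hom, push_id, push_comp, map_sub, hg, hΨ', sub_self]
  have h2 := h1 Y ξ
  rwa [X.push_sub_hom, push_id, push_comp, (hT.cofactorsThrough_iff x).1 ⟨𝟙 B, Category.comp_id x⟩,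
    map_zero, sub_zero] at h2

section Artinian

variable [IsArtinianRing k]

/-- By finiteness, nondegeneracy of the pairing on the side of the extensions suffices for every
functional to be represented. -/
theorem IsUniversal.of_nondegenerate (hfin : X.ExtFinite) {Z T : C} {Φ : D k (Extn X.E Z T)}
    (h : ∀ ⦃M : C⦄ (μ : Extn X.E Z M), μ ≠ 0 → ∃ g : M ⟶ T, Φ (push g μ) ≠ 0)
    (h' : ∀ ⦃M : C⦄ (g : M ⟶ T), g ∉ X.injMor M T → ∃ μ : Extn X.E Z M, Φ (push g μ) ≠ 0) :
    X.IsUniversal Φ := by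
  refine ⟨fun M Ψ => ?_, fun M g hg => ?_⟩
  · by_contra hΨ
    have hΨ' : Ψ ∉ LinearMap.range (X.pairing Φ M) := by
      rintro ⟨g, rfl⟩
      exact hΨ ⟨g, fun μ => rfl⟩
    have := hfin Z M
    obtain ⟨μ, hμ, hne⟩ := exists_separating _ hΨ'
    obtain ⟨g, hg⟩ := h μ (by rintro rfl; exact hne (map_zero _))
    exact hg (hμ _ ⟨g, rfl⟩)
  · by_contra hne
    obtain ⟨μ, hμ⟩ := h' g hne
    exact hμ (hg μ)

/-- Functionals on `E(Z, A)` that do not vanish on an almost split extension are universal. -/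
theorem AlmostSplit.memCr (hfin : X.ExtFinite) {Z A : C} {δ : Extn X.E Z A}
    (h : X.AlmostSplit δ) : X.MemCr Z := by
  obtain ⟨Φ, hΦ⟩ := exists_dual_ne_zero (k := k) h.1
  refine memCr_iff_exists_isUniversal.2 ⟨A, Φ, .of_nondegenerate hfin ?_ ?_⟩
  · intro M μ hμ
    obtain ⟨B, x, y, hT⟩ := X.exists_isTriangle μ
    obtain ⟨g, rfl⟩ := hT.exists_push_eq (h.2.2 y fun hy => hμ (hT.isSplitEpi_iff.1 hy))
    exact ⟨g, hΦ⟩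
  · intro M g hg
    obtain ⟨W, μ, hμ⟩ : ∃ (W : C) (μ : Extn X.E W M), push g μ ≠ 0 := by
      by_contra! hall
      exact hg hall
    obtain ⟨B, x, y, hT⟩ := X.exists_isTriangle (push g μ)
    obtain ⟨c, rfl⟩ := hT.exists_pull_eq (h.2.1 x fun hx => hμ (hT.isSplitMono_iff.1 hx))
    exact ⟨pull c μ, by rwa [push_pull]⟩

/-- The class of objects `Z` with `D E(Z, -)` representable is closed under finite direct sums. -/
theorem MemCr.biproduct (hfin : X.ExtFinite) {n : ℕ} {F : Fin n → C} (h : ∀ i, X.MemCr (F i))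
    {Z : C} (e : Z ≅ ⨁ F) : X.MemCr Z := by
  classical
  choose T Φ hΦ using fun i => memCr_iff_exists_isUniversal.1 (h i)
  let p : ∀ i, Z ⟶ F i := fun i => e.hom ≫ biproduct.π F i
  let q : ∀ i, F i ⟶ Z := fun i => biproduct.ι F i ≫ e.inv
  have htot : ∑ i, p i ≫ q i = 𝟙 Z := sum_comp_eq_id_of_iso_biproduct e
  have hqp : ∀ i, q i ≫ p i = 𝟙 _ := fun i => by simp [p, q]
  have hqp' : ∀ i j, i ≠ j → q i ≫ p j = 0 := fun i j hij => by simp [p, q, biproduct.ι_π_ne _ hij]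
  let Ψ : D k (Extn X.E Z (⨁ T)) := ∑ i, Φ i ∘ₗ push (biproduct.π T i) ∘ₗ pull (q i)
  have hΨ : ∀ ξ, Ψ ξ = ∑ i, Φ i (push (biproduct.π T i) (pull (q i) ξ)) := fun ξ => by
    simp [Ψ]
  refine memCr_iff_exists_isUniversal.2 ⟨⨁ T, Ψ, .of_nondegenerate hfin ?_ ?_⟩
  · intro M μ hμ
    obtain ⟨i, hi⟩ : ∃ i, pull (q i) μ ≠ 0 := by
      by_contra! hall
      apply hμ
      rw [← pull_id μ, ← htot, X.pull_sum]
      exact Finset.sum_eq_zero fun i _ => by rw [pull_comp, hall, map_zero]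
    obtain ⟨Θ, hΘ⟩ := exists_dual_ne_zero (k := k) hi
    obtain ⟨g, hg⟩ := (hΦ i).1 Θ
    refine ⟨g ≫ biproduct.ι T i, ?_⟩
    rw [hΨ, Finset.sum_eq_single i]
    · rw [← push_pull, ← push_comp]
      simpa [hg] using hΘ
    · intro j _ hj
      rw [← push_pull, ← push_comp, Category.assoc, biproduct.ι_π_ne _ hj.symm, comp_zero,
        X.push_zero_hom, map_zero]
    · simp
  · intro M g hg
    obtain ⟨i, hi⟩ : ∃ i, g ≫ biproduct.π T i ∉ X.injMor M (T i) := by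
      by_contra! hall
      apply hg
      intro A δ
      have : g = ∑ i, (g ≫ biproduct.π T i) ≫ biproduct.ι T i := by
        simp [← Preadditive.comp_sum, biproduct.total]
      rw [this, X.push_sum]
      exact Finset.sum_eq_zero fun i _ => by rw [push_comp, hall i A δ, map_zero]
    obtain ⟨μ, hμ⟩ : ∃ μ, Φ i (push (g ≫ biproduct.π T i) μ) ≠ 0 := by
      by_contra! hall
      exact hi ((hΦ i).2 _ hall)
    refine ⟨pull (p i) μ, ?_⟩
    rw [hΨ, Finset.sum_eq_single i]
    · rwa [push_pull, ← push_comp, push_pull, ← pull_comp, hqp, pull_id]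
    · intro j _ hj
      rw [push_pull, ← push_comp, push_pull, ← pull_comp, hqp' j i hj, X.pull_zero_hom, map_zero]
    · simp

theorem ProjObj.memCr (hfin : X.ExtFinite) {Z : C} (hZ : X.ProjObj Z) : X.MemCr Z := by
  have h0 : ∀ {M : C} (μ : Extn X.E Z M), μ = 0 := fun μ => by rw [← pull_id μ, hZ]
  obtain ⟨O, hO⟩ : ∃ O : C, IsZero O :=
    ⟨⨁ (Fin.elim0 : Fin 0 → C), by
      rw [IsZero.iff_id_eq_zero]
      exact biproduct.hom_ext _ _ fun j => j.elim0⟩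
  refine memCr_iff_exists_isUniversal.2 ⟨O, 0, .of_nondegenerate hfin ?_ ?_⟩
  · exact fun M μ hμ => (hμ (h0 μ)).elim
  · intro M g hg
    rw [hO.eq_of_tgt g 0] at hg
    exact (hg (Submodule.zero_mem _)).elim

/-! ### Determined deflations -/

theorem IsUniversal.projMor_of_pull {Z T : C} {Φ : D k (Extn X.E Z T)} (hΦ : X.IsUniversal Φ)
    {Y : C} {f : Z ⟶ Y} (h : ∀ ξ : Extn X.E Y T, Φ (pull f ξ) = 0) : X.ProjMor f := by
  intro A δ
  by_contra hne
  obtain ⟨Ψ, hΨ⟩ := exists_dual_ne_zero (k := k) hne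
  obtain ⟨g, hg⟩ := hΦ.1 Ψ
  apply hΨ
  rw [← hg, push_pull, h]

variable (X) in
/-- Every `End Z`-submodule of `C(Z, Y)` containing the `s`-projective morphisms is the image of
`C(Z, α)` for a right `Z`-determined `s`-deflation `α`. -/
def HasDeterminedDeflations (Z : C) : Prop :=
  ∀ (Y : C) (H : Submodule (End Z)ᵐᵒᵖ (Z ⟶ Y)), (∀ f : Z ⟶ Y, X.ProjMor f → f ∈ H) →
    ∃ (B : C) (α : B ⟶ Y), X.IsDeflation α ∧ RightDetermined Z α ∧
      (H : Set (Z ⟶ Y)) = Set.range (fun g : Z ⟶ B => g ≫ α)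

/-- The deflation for `H` is realized by generators of the annihilator of `H` in `E(Y, T)`, where
`T` represents `D E(Z, -)`. -/
theorem MemCr.hasDeterminedDeflations (hfin : X.ExtFinite) {Z : C} (hZ : X.MemCr Z) :
    X.HasDeterminedDeflations Z := by
  intro Y H hH
  obtain ⟨T, Φ, hΦ⟩ := memCr_iff_exists_isUniversal.1 hZ
  have := hfin Y T
  let ev : (Z ⟶ Y) →ₗ[k] D k (Extn X.E Y T) :=
    { toFun := fun f => Φ ∘ₗ pull f
      map_add' := fun f g => by ext μ; simp [X.bilinear.pull_add]
      map_smul' := fun r f => by ext μ; simp [X.bilinear.pull_smul] }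
  have hcomp : ∀ (c : Z ⟶ Z) (f : Z ⟶ Y), f ∈ H → c ≫ f ∈ H := fun c f hf =>
    H.smul_mem (MulOpposite.op (show End Z from c)) hf
  let H' : Submodule k (Z ⟶ Y) :=
    { carrier := H
      add_mem' := fun {f g} hf hg => H.add_mem hf hg
      zero_mem' := H.zero_mem
      smul_mem' := fun r f hf => by
        have := hcomp (r • 𝟙 Z) f hf
        rwa [Linear.smul_comp, Category.id_comp] at this }
  let P : Submodule k (Extn X.E Y T) :=
    { carrier := {ξ | ∀ f ∈ H, pull f ξ = 0}
      add_mem' := fun {ξ ξ'} hξ hξ' f hf => by rw [map_add, hξ f hf, hξ' f hf, add_zero]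
      zero_mem' := fun f _ => map_zero _
      smul_mem' := fun r ξ hξ f hf => by rw [map_smul, hξ f hf, smul_zero] }
  -- `H` is its own double annihilator
  have hperp : ∀ f : Z ⟶ Y, (∀ ξ ∈ P, pull f ξ = 0) → f ∈ H := by
    intro f hf
    by_contra hne
    have h1 : ev f ∉ H'.map ev := by
      rintro ⟨f', hf', heq⟩
      apply hne
      have h2 : X.ProjMor (f - f') := hΦ.projMor_of_pull fun ξ => by
        have := LinearMap.congr_fun heq ξ
        have h3 : Φ (pull f' ξ) = Φ (pull f ξ) := this
        rw [X.pull_sub_hom, map_sub, h3, sub_self]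
      have h4 := H.add_mem (hH _ h2) hf'
      rwa [sub_add_cancel] at h4
    obtain ⟨ξ, hξ, hξ'⟩ := exists_separating _ h1
    apply hξ'
    have h5 : ξ ∈ P := fun f' hf' => hΦ.eq_zero_of_pull fun c => by
      rw [← pull_comp]
      exact hξ _ ⟨c ≫ f', hcomp c f' hf', rfl⟩
    change Φ (pull f ξ) = 0
    rw [hf ξ h5, map_zero]
  obtain ⟨n, s, hs⟩ := Submodule.fg_iff_exists_fin_generating_family.1 (IsNoetherian.noetherian P)
  let Ξ : Extn X.E Y (⨁ fun _ : Fin n => T) :=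
    ∑ i, push (biproduct.ι (fun _ : Fin n => T) i) (s i)
  have hΞ : ∀ {W : C} (f : W ⟶ Y), pull f Ξ = 0 ↔ ∀ i, pull f (s i) = 0 := by
    classical
    intro W f
    constructor
    · intro h i
      have h1 : push (biproduct.π (fun _ : Fin n => T) i) Ξ = s i := by
        rw [map_sum, Finset.sum_eq_single i]
        · rw [← push_comp, biproduct.ι_π_self, push_id]
        · intro j _ hj
          rw [← push_comp, biproduct.ι_π_ne _ hj, X.push_zero_hom]
        · simp
      rw [← h1, ← push_pull, h, map_zero]
    · intro h
      rw [map_sum]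
      exact Finset.sum_eq_zero fun i _ => by rw [← push_pull, h i, map_zero]
  obtain ⟨B, x, α, hT⟩ := X.exists_isTriangle Ξ
  refine ⟨B, α, ⟨_, x, Ξ, hT⟩, ?_, ?_⟩
  · intro W g hg
    rw [hT.factorsThrough_iff, hΞ]
    intro i
    refine hΦ.eq_zero_of_pull fun c => ?_
    have h1 := hg c
    rw [hT.factorsThrough_iff, hΞ] at h1
    rw [← pull_comp, h1 i, map_zero]
  · ext f
    have hsP : ∀ i, s i ∈ P := fun i => hs ▸ Submodule.subset_span ⟨i, rfl⟩
    have h1 : f ∈ H ↔ FactorsThrough f α := by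
      rw [hT.factorsThrough_iff, hΞ]
      refine ⟨fun hf i => hsP i f hf, fun hf => hperp f fun ξ hξ => ?_⟩
      have h2 : P ≤ LinearMap.ker (pull f : Extn X.E Y T →ₗ[k] Extn X.E Z T) := by
        rw [← hs, Submodule.span_le]
        rintro _ ⟨i, rfl⟩
        exact hf i
      exact h2 hξ
    exact h1

end Artinian

/-- The non-retractions from `Z` to a local summand `W` form a submodule, and the deflation that it
determines is right almost split. -/
theorem HasDeterminedDeflations.exists_almostSplit (hKS : KrullSchmidt C) {Z W : C}
    (hZ : X.HasDeterminedDeflations Z) (p : Z ⟶ W) (hp : IsSplitEpi p) [IsLocalRing (End W)]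
    (hW : ¬ X.ProjObj W) : ∃ (A : C) (δ : Extn X.E W A), X.AlmostSplit δ := by
  let H : Submodule (End Z)ᵐᵒᵖ (Z ⟶ W) :=
    { carrier := {f | ¬ IsSplitEpi f}
      add_mem' := by
        rintro f g hf hg ⟨⟨s, hs⟩⟩
        have h1 := isIso_one_sub_comp_of_not_isSplitEpi s hf
        rw [← hs, Preadditive.comp_add, add_sub_cancel_left] at h1
        exact hg (isSplitEpi_of_isIso_comp s g)
      zero_mem' := by
        rintro ⟨⟨s, hs⟩⟩
        rw [comp_zero] at hs
        exact id_ne_zero_of_isLocalRing W hs.symm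
      smul_mem' := by
        rintro c f hf ⟨⟨s, hs⟩⟩
        exact hf ⟨⟨⟨s ≫ c.unop, by rw [Category.assoc]; exact hs⟩⟩⟩ }
  obtain ⟨B, α, ⟨A, x, δ, hT⟩, hdet, hH⟩ := hZ W H fun f hf hsplit => hW (.of_isSplitEpi hf)
  have hH' : ∀ f : Z ⟶ W, ¬ IsSplitEpi f ↔ FactorsThrough f α := fun f => Set.ext_iff.1 hH f
  refine exists_almostSplit_of_pull_eq_zero hKS (δ := δ) ?_ ?_
  · intro h0
    obtain ⟨⟨s, hs⟩⟩ := hT.isSplitEpi_iff.2 h0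
    exact (hH' p).2 ⟨p ≫ s, by rw [Category.assoc, hs, Category.comp_id]⟩ hp
  · intro V c hc
    rw [← hT.factorsThrough_iff]
    refine hdet c fun h => (hH' _).1 ?_
    rintro ⟨⟨s, hs⟩⟩
    exact hc ⟨⟨⟨s ≫ h, by rw [Category.assoc, hs]⟩⟩⟩

theorem HasDeterminedDeflations.memCr [IsArtinianRing k] (hfin : X.ExtFinite)
    (hKS : KrullSchmidt C) {Z : C} (hZ : X.HasDeterminedDeflations Z) : X.MemCr Z := by
  obtain ⟨n, F, hF, ⟨e⟩⟩ := hKS Z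
  refine MemCr.biproduct hfin (fun i => ?_) e
  by_cases hi : X.ProjObj (F i)
  · exact hi.memCr hfin
  · have := hF i
    obtain ⟨A, δ, hδ⟩ := hZ.exists_almostSplit hKS (e.hom ≫ biproduct.π F i)
      ⟨⟨⟨biproduct.ι F i ≫ e.inv, by simp⟩⟩⟩ hi
    exact hδ.memCr hfin

/-! ### Almost factorizations and intrinsic weak cokernels -/

/-- `End A` acting on `E(Z, A)`. -/
def pushAction (X : LinearExtriangulated.{u, v, t, w} k C) (Z A : C) :
    End A →ₐ[k] Module.End k (Extn X.E Z A) :=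
  AlgHom.ofLinearMap
    { toFun := fun a => push a
      map_add' := fun a b => by ext δ; exact X.bilinear.push_add a b δ
      map_smul' := fun r a => by ext δ; exact X.bilinear.push_smul r a δ }
    (by ext δ; exact push_id δ)
    (fun a b => by ext δ; exact push_comp (show A ⟶ A from b) a δ)

/-- `End Z` acting on `E(Z, A)` from the right. -/
def pullAction (X : LinearExtriangulated.{u, v, t, w} k C) (Z A : C) :
    (End Z)ᵐᵒᵖ →ₐ[k] Module.End k (Extn X.E Z A) :=
  AlgHom.ofLinearMap
    { toFun := fun c => pull c.unop
      map_add' := fun a b => by ext δ; exact X.bilinear.pull_add a.unop b.unop δ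
      map_smul' := fun r a => by ext δ; exact X.bilinear.pull_smul r a.unop δ }
    (by ext δ; exact pull_id δ)
    (fun a b => by ext δ; exact pull_comp (show Z ⟶ Z from b.unop) a.unop δ)

/-- A map `Z ⟶ Y` almost factors through a right `Z`-determined deflation if the pullback of the
extension along it lies in the socle of the `End Z`-module `E(Z, A)`. -/
theorem exists_almostFactorsThrough [IsArtinianRing k] (hfin : X.ExtFinite) {Z B Y : C}
    [IsLocalRing (End Z)] {α : B ⟶ Y} (hα : X.IsDeflation α) (hsplit : ¬ IsSplitEpi α)
    (hdet : RightDetermined Z α) : ∃ f : Z ⟶ Y, AlmostFactorsThrough f α := by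
  obtain ⟨A, x, δ, hT⟩ := hα
  obtain ⟨f, hf⟩ : ∃ f : Z ⟶ Y, pull f δ ≠ 0 := by
    by_contra! h
    apply hsplit
    obtain ⟨s, hs⟩ := hdet (𝟙 Y) fun f => by
      rw [Category.comp_id, hT.factorsThrough_iff]; exact h f
    exact ⟨⟨⟨s, hs⟩⟩⟩
  have := hfin Z A
  obtain ⟨c, hc, hrad⟩ := exists_smul_mem_socle (X.pullAction Z A) hf
  have hc' : pull (show Z ⟶ Z from c.unop) (pull f δ) ≠ 0 := hc
  have hrad' : ∀ j : Z ⟶ Z, ¬ IsSplitEpi j →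
      pull j (pull (show Z ⟶ Z from c.unop) (pull f δ)) = 0 := by
    intro j hj
    refine hrad (MulOpposite.op (show End Z from j)) fun s => ?_
    rw [← isUnit_unop, isUnit_iff_isIso]
    exact isIso_one_sub_comp_of_not_isSplitEpi (show Z ⟶ Z from s.unop) hj
  refine ⟨(show Z ⟶ Z from c.unop) ≫ f, ?_, fun T h hh => hdet _ fun e => ?_⟩
  · rwa [hT.factorsThrough_iff, pull_comp]
  · have h1 := hh e (𝟙 Z)
    rw [Category.comp_id] at h1
    have h2 := hrad' _ (not_isSplitEpi_of_mem_jacobson h1)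
    rw [← pull_comp, ← pull_comp] at h2
    rw [hT.factorsThrough_iff, ← Category.assoc, ← Category.assoc]
    exact h2

theorem AlmostFactorsThrough.exists_almostSplit (hKS : KrullSchmidt C) {Z B Y : C}
    [IsLocalRing (End Z)] {α : B ⟶ Y} (hα : X.IsDeflation α) {f : Z ⟶ Y}
    (hf : AlmostFactorsThrough f α) : ∃ (A : C) (δ : Extn X.E Z A), X.AlmostSplit δ := by
  obtain ⟨A, x, δ, hT⟩ := hα
  refine exists_almostSplit_of_pull_eq_zero hKS (δ := pull f δ) ?_ fun T h hh => ?_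
  · rw [Ne, ← hT.factorsThrough_iff]
    exact hf.1
  · rw [← pull_comp, ← hT.factorsThrough_iff]
    exact hf.2 h (inRadical_of_not_isSplitEpi hh)

/-- A left determined inflation that does not split, with cokernel term `Z`, has a pushout that is
almost split: it comes from an element in the socle of the `End K`-module `E(Z, K)`. -/
theorem LeftDetermined.exists_almostSplit [IsArtinianRing k] (hfin : X.ExtFinite)
    (hKS : KrullSchmidt C) {A B Z K : C} [IsLocalRing (End Z)] {x : A ⟶ B} {y : B ⟶ Z}
    {δ : Extn X.E Z A} (hT : X.IsTriangle x y δ) (hδ : δ ≠ 0) (hdet : LeftDetermined K x) :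
    ∃ (A' : C) (δ' : Extn X.E Z A'), X.AlmostSplit δ' := by
  obtain ⟨f, hf⟩ : ∃ f : A ⟶ K, push f δ ≠ 0 := by
    by_contra! h
    apply hδ
    rw [← push_id δ, ← hT.cofactorsThrough_iff]
    refine hdet (𝟙 A) fun f => ?_
    rw [Category.id_comp, hT.cofactorsThrough_iff]
    exact h f
  have := hfin Z K
  obtain ⟨c, hc, hrad⟩ := exists_smul_mem_socle (X.pushAction Z K) hf
  have hc' : push (show K ⟶ K from c) (push f δ) ≠ 0 := hc
  obtain ⟨A', p, hA', hp⟩ := exists_local_push_ne_zero hKS hc'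
  refine ⟨A', _, .of_push_eq_zero hp fun T a ha => ?_⟩
  -- by determinedness it is enough to postcompose with maps `e : T ⟶ K`; then `p ≫ a ≫ e` is in
  -- the radical of `End K`
  rw [← push_comp, ← push_comp, ← push_comp, ← hT.cofactorsThrough_iff]
  refine hdet _ fun e => ?_
  rw [hT.cofactorsThrough_iff]
  have h1 := hrad (show K ⟶ K from p ≫ a ≫ e) fun s => by
    rw [isUnit_iff_isIso]
    have h2 := isIso_one_sub_comp_of_not_isSplitMono ha (e ≫ (show K ⟶ K from s) ≫ p)
    have h3 : IsIso (𝟙 A' - (a ≫ e ≫ (show K ⟶ K from s)) ≫ p) := by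
      simpa only [Category.assoc] using h2
    have h4 := isIso_one_sub_comm _ _ h3
    have h5 : p ≫ a ≫ e ≫ (show K ⟶ K from s) = (p ≫ a ≫ e) ≫ (show K ⟶ K from s) := by simp
    rw [h5] at h4
    exact h4
  have h6 : push (p ≫ a ≫ e) (push (show K ⟶ K from c) (push f δ)) = 0 := h1
  rw [← push_comp, ← push_comp] at h6
  simpa only [Category.assoc] using h6

end LinearExtriangulated
end ExtriCat


theorem theorem4p11 {k : Type u} [CommRing k] [IsArtinianRing k]
    {C : Type t} [Category.{v} C] [Preadditive C] [Linear k C] [HasFiniteBiproducts C]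
    [HasBinaryBiproducts C] (𝓧 : ExtriCat.LinearExtriangulated.{u, v, t, w} k C)
    (hfin : 𝓧.ExtFinite) (hKS : ExtriCat.KrullSchmidt C) (hWIC : 𝓧.WIC) (Z : C) :
    (𝓧.MemCr Z ↔
      ∀ (Y : C) (H : Submodule (End Z)ᵐᵒᵖ (Z ⟶ Y)), (∀ f : Z ⟶ Y, 𝓧.ProjMor f → f ∈ H) →
        ∃ (X : C) (α : X ⟶ Y), 𝓧.IsDeflation α ∧ ExtriCat.RightDetermined Z α ∧
          (H : Set (Z ⟶ Y)) = Set.range (fun g : Z ⟶ X => g ≫ α)) ∧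
    (Indecomposable Z → ¬ 𝓧.ProjObj Z →
      List.TFAE [
        𝓧.MemCr Z,
        ∀ (Y : C) (H : Submodule (End Z)ᵐᵒᵖ (Z ⟶ Y)), (∀ f : Z ⟶ Y, 𝓧.ProjMor f → f ∈ H) →
          ∃ (X : C) (α : X ⟶ Y), 𝓧.IsDeflation α ∧ ExtriCat.RightDetermined Z α ∧
            (H : Set (Z ⟶ Y)) = Set.range (fun g : Z ⟶ X => g ≫ α),
        ∃ (X Y : C) (α : X ⟶ Y), 𝓧.IsIntrinsicWeakCokernel Z α ∧
          ∃ K : C, ExtriCat.LeftDetermined K α,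
        ∃ (A B : C) (x : A ⟶ B) (y : B ⟶ Z) (δ : ExtriCat.Extn 𝓧.E Z A),
          𝓧.IsTriangle x y δ ∧ 𝓧.AlmostSplit δ,
        ∃ (X Y : C) (α : X ⟶ Y), 𝓧.IsDeflation α ∧ ¬ IsSplitEpi α ∧
          ExtriCat.RightDetermined Z α,
        ∃ (X Y : C) (α : X ⟶ Y) (f : Z ⟶ Y), 𝓧.IsDeflation α ∧
          ExtriCat.AlmostFactorsThrough f α]) := by
  refine ⟨⟨fun h => h.hasDeterminedDeflations hfin, fun h =>
    ExtriCat.LinearExtriangulated.HasDeterminedDeflations.memCr hfin hKS h⟩, fun hind hproj => ?_⟩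
  have := ExtriCat.isLocalRing_end_of_indecomposable hKS hind
  tfae_have 1 → 2 := fun h => h.hasDeterminedDeflations hfin
  tfae_have 2 → 4 := fun h => by
    obtain ⟨A, δ, hδ⟩ :=
      ExtriCat.LinearExtriangulated.HasDeterminedDeflations.exists_almostSplit hKS h (𝟙 Z)
        inferInstance hproj
    obtain ⟨B, x, y, hT⟩ := 𝓧.exists_isTriangle δ
    exact ⟨A, B, x, y, δ, hT, hδ⟩
  tfae_have 4 → 1 := fun ⟨A, B, x, y, δ, hT, hδ⟩ => hδ.memCr hfin
  tfae_have 4 → 3 := fun ⟨A, B, x, y, δ, hT, hδ⟩ =>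
    ⟨A, B, x, ⟨⟨Z, y, δ, hT⟩, B, x, y, δ, hT.leftMinimal hδ.1,
      ⟨⟨𝟙 B, Category.comp_id x⟩, 𝟙 B, Category.comp_id x⟩, hT⟩, A, hδ.leftDetermined hT⟩
  tfae_have 3 → 4 := fun ⟨A, Y, α, ⟨_, B, g, h, δ, hmin, heq, hT⟩, K, hK⟩ => by
    obtain ⟨A', δ', hδ'⟩ := ExtriCat.LinearExtriangulated.LeftDetermined.exists_almostSplit hfin hKS
      hT (hT.ne_zero_of_leftMinimal hmin hind.1)
      (ExtriCat.LeftDetermined.of_leftEquivalent heq hK)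
    obtain ⟨B', x, y, hT'⟩ := 𝓧.exists_isTriangle δ'
    exact ⟨A', B', x, y, δ', hT', hδ'⟩
  tfae_have 4 → 5 := fun ⟨A, B, x, y, δ, hT, hδ⟩ =>
    ⟨B, Z, y, ⟨A, x, δ, hT⟩, fun hy => hδ.1 (hT.isSplitEpi_iff.1 hy), hδ.rightDetermined hT⟩
  tfae_have 5 → 6 := fun ⟨B, Y, α, hα, hsplit, hdet⟩ => by
    obtain ⟨f, hf⟩ := ExtriCat.LinearExtriangulated.exists_almostFactorsThrough hfin hα hsplit hdet
    exact ⟨B, Y, α, f, hα, hf⟩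
  tfae_have 6 → 4 := fun ⟨B, Y, α, f, hα, hf⟩ => by
    obtain ⟨A, δ, hδ⟩ :=
      ExtriCat.LinearExtriangulated.AlmostFactorsThrough.exists_almostSplit hKS hα hf
    obtain ⟨B', x, y, hT⟩ := 𝓧.exists_isTriangle δ
    exact ⟨A, B', x, y, δ, hT, hδ⟩
  tfae_finish
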